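/- Let $\mathcal{M}$ be a monoidal bicategory, with tensor product written as juxtaposition and unit object $I$; coherence isomorphisms are suppressed. A *right skew monoidale* is an object $M$ with arrows $m\colon MM\to M$, $u\colon I\to M$ and (not necessarily invertible) cells $\alpha\colon m(1m)\Rightarrow m(m1)$, $\lambda\colon 1\Rightarrow m(u1)$, $\rho\colon m(1u)\Rightarrow 1$ satisfying the five skew monoidal axioms. An *oplax right action* of $M$ on an object $A$ is an arrow $a\colon AM\to A$ with cells $a^2\colon a(1m)\Rightarrow a(a1)$ and $a^0\colon a(1u)\Rightarrow 1$ satisfying the pentagon and the two unit axioms. An *opmonoidal monad* on $M$ is a monad $(B,\mu,\eta)$ on $M$ in the bicategory of right skew monoidales, opmonoidal arrows (with constraints $B^2\colon Bm\Rightarrow m(BB)$, $B^0\colon Bu\Rightarrow u$) and opmonoidal cells. For such $a$ and $B$, a *right $B$-comodule from $a$ to $a$* is an arrow $Y\colon A\to A$ with a cell $y\colon Ya\Rightarrow a(YB)$ that is coassociative with respect to $a^2,B^2$ and counital with respect to $a^0,B^0$; a morphism $(Y,y)\to(Y',y')$ is a cell $\gamma\colon Y\Rightarrow Y'$ with $y'\cdot(\gamma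 a)=a(\gamma B)\cdot y$. These form a category $\mathrm{rComod}_B((A,a),(A,a))$. **Theorem.** For every object $A$, every right skew monoidale $M$, every oplax right action $a\colon AM\to A$ and every opmonoidal monad $B\colon M\to M$, the category $\mathrm{rComod}_B((A,a),(A,a))$ has a monoidal structure such that the forgetful functor $(Y,y)\mapsto Y$ to $\mathcal{M}(A,A)$, which is monoidal under composition, is strong monoidal (with identity constraints). The tensor product of $(Y,y)$ and $(Z,z)$ is the composite $ZY$ (first $Y$, then $Z$) with coaction $$ZYa\xrightarrow{\;Zy\;}Za(YB)\xrightarrow{\;z(YB)\;}a(ZB)(YB)\cong a\big((ZY)(BB)\big)\xrightarrow{\;a((ZY)\mu)\;}a\big((ZY)B\big),$$ where $BB$ in $(ZY)(BB)$ and $ZY$ denote composites, and the unit is the identity arrow $1_A$ with coaction $a\cong a(1_A1_M)\xrightarrow{\;a(1_A\eta)\;}a(1_AB)$. **Corollary.** Let $R\dashv R^\circ$ be a biduality in $\mathcal{M}$, that is, arrows $n\colon I\to R^\circ R$ and $e\colon RR^\circ\to I$ with invertible triangle cells $\varsigma_l,\varsigma_r$ satisfying the two swallowtail equations. Equip $R^\circ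 R$ with its enveloping structure (product $1e1$, unit $n$, associator the interchange isomorphism, unitors $\varsigma_l1$ and $1\varsigma_r$), and let it act on $R$ by $e1\colon RR^\circ R\to R$ (associator the interchange isomorphism, right unitor $\varsigma_r$). Then for every opmonoidal monad $B\colon R^\circ R\to R^\circ R$ the category $\mathrm{rComod}_B((R,e1),(R,e1))$ has a monoidal structure, with tensor product and unit as in the Theorem, such that the forgetful functor to $\mathcal{M}(R,R)$ is strong monoidal. -/

import Mathlib

open CategoryTheory Bicategory

universe w v u

/-! ### Monoidal bicategories

A monoidal bicategory is a bicategory with a tensor pseudofunctor, a unit object, pseudonatural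
adjoint equivalences for associativity and the two unit laws, and invertible modifications
(pentagonator and three unit modifications) subject to the tricategory axioms.  All of this is
written out in components.  Composition is written in diagrammatic order throughout. -/

/-- The tensor pseudofunctor `𝓜 × 𝓜 ⥤ 𝓜` of a monoidal bicategory, in components. -/
class TensorBicategory (𝓜 : Type u) [Bicategory.{w, v} 𝓜] where
  tensorObj : 𝓜 → 𝓜 → 𝓜
  tensorHom {X Y X' Y' : 𝓜} (f : X ⟶ Y) (f' : X' ⟶ Y') : tensorObj X X' ⟶ tensorObj Y Y'
  tensorCell {X Y X' Y' : 𝓜} {f g : X ⟶ Y} {f' g' : X' ⟶ Y'} (η : f ⟶ g) (η' : f' ⟶ g') :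
    tensorHom f f' ⟶ tensorHom g g'
  tensorCell_id {X Y X' Y' : 𝓜} (f : X ⟶ Y) (f' : X' ⟶ Y') :
    tensorCell (𝟙 f) (𝟙 f') = 𝟙 (tensorHom f f')
  tensorCell_comp {X Y X' Y' : 𝓜} {f g h : X ⟶ Y} {f' g' h' : X' ⟶ Y'}
    (η : f ⟶ g) (θ : g ⟶ h) (η' : f' ⟶ g') (θ' : g' ⟶ h') :
    tensorCell (η ≫ θ) (η' ≫ θ') = tensorCell η η' ≫ tensorCell θ θ'
  /-- the constraint for identities -/
  tensorId (X Y : 𝓜) : tensorHom (𝟙 X) (𝟙 Y) ≅ 𝟙 (tensorObj X Y)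
  /-- the constraint for composition (the interchange law) -/
  tensorComp {X Y Z X' Y' Z' : 𝓜} (f : X ⟶ Y) (g : Y ⟶ Z) (f' : X' ⟶ Y') (g' : Y' ⟶ Z') :
    tensorHom (f ≫ g) (f' ≫ g') ≅ tensorHom f f' ≫ tensorHom g g'
  tensorComp_whiskerLeft {X Y Z X' Y' Z' : 𝓜} (f : X ⟶ Y) {g h : Y ⟶ Z} (η : g ⟶ h)
    (f' : X' ⟶ Y') {g' h' : Y' ⟶ Z'} (η' : g' ⟶ h') :
    tensorCell (f ◁ η) (f' ◁ η') ≫ (tensorComp f h f' h').hom =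
      (tensorComp f g f' g').hom ≫ tensorHom f f' ◁ tensorCell η η'
  tensorComp_whiskerRight {X Y Z X' Y' Z' : 𝓜} {f g : X ⟶ Y} (η : f ⟶ g) (h : Y ⟶ Z)
    {f' g' : X' ⟶ Y'} (η' : f' ⟶ g') (h' : Y' ⟶ Z') :
    tensorCell (η ▷ h) (η' ▷ h') ≫ (tensorComp g h g' h').hom =
      (tensorComp f h f' h').hom ≫ tensorCell η η' ▷ tensorHom h h'
  tensorComp_assoc {X Y Z W X' Y' Z' W' : 𝓜} (f : X ⟶ Y) (g : Y ⟶ Z) (h : Z ⟶ W)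
    (f' : X' ⟶ Y') (g' : Y' ⟶ Z') (h' : Z' ⟶ W') :
    tensorCell (α_ f g h).hom (α_ f' g' h').hom ≫ (tensorComp f (g ≫ h) f' (g' ≫ h')).hom ≫
        tensorHom f f' ◁ (tensorComp g h g' h').hom =
      (tensorComp (f ≫ g) h (f' ≫ g') h').hom ≫ (tensorComp f g f' g').hom ▷ tensorHom h h' ≫
        (α_ (tensorHom f f') (tensorHom g g') (tensorHom h h')).hom
  tensorComp_id_left {X Y X' Y' : 𝓜} (f : X ⟶ Y) (f' : X' ⟶ Y') :
    tensorCell (λ_ f).hom (λ_ f').hom =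
      (tensorComp (𝟙 X) f (𝟙 X') f').hom ≫ (tensorId X X').hom ▷ tensorHom f f' ≫
        (λ_ (tensorHom f f')).hom
  tensorComp_id_right {X Y X' Y' : 𝓜} (f : X ⟶ Y) (f' : X' ⟶ Y') :
    tensorCell (ρ_ f).hom (ρ_ f').hom =
      (tensorComp f (𝟙 Y) f' (𝟙 Y')).hom ≫ tensorHom f f' ◁ (tensorId Y Y').hom ≫
        (ρ_ (tensorHom f f')).hom

infixl:90 " ⊠ " => TensorBicategory.tensorObj
infixl:90 " ⊠₁ " => TensorBicategory.tensorHom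
infixl:90 " ⊠₂ " => TensorBicategory.tensorCell

namespace TensorBicategory

variable {𝓜 : Type u} [Bicategory.{w, v} 𝓜] [TensorBicategory 𝓜]

/-- The tensor product of two invertible cells. -/
def tensorIso {X Y X' Y' : 𝓜} {f g : X ⟶ Y} {f' g' : X' ⟶ Y'} (η : f ≅ g) (η' : f' ≅ g') :
    f ⊠₁ f' ≅ g ⊠₁ g' where
  hom := η.hom ⊠₂ η'.hom
  inv := η.inv ⊠₂ η'.inv
  hom_inv_id := by rw [← tensorCell_comp, Iso.hom_inv_id, Iso.hom_inv_id, tensorCell_id]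
  inv_hom_id := by rw [← tensorCell_comp, Iso.inv_hom_id, Iso.inv_hom_id, tensorCell_id]

/-- The tensor product of two squares that commute up to an invertible cell. -/
def tensorSq {X Y Y₁ Z X' Y' Y₁' Z' : 𝓜} {f : X ⟶ Y} {p : Y ⟶ Z} {q : X ⟶ Y₁} {g : Y₁ ⟶ Z}
    {f' : X' ⟶ Y'} {p' : Y' ⟶ Z'} {q' : X' ⟶ Y₁'} {g' : Y₁' ⟶ Z'}
    (σ : f ≫ p ≅ q ≫ g) (σ' : f' ≫ p' ≅ q' ≫ g') :
    (f ⊠₁ f') ≫ (p ⊠₁ p') ≅ (q ⊠₁ q') ≫ (g ⊠₁ g') :=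
  (tensorComp f p f' p').symm ≪≫ tensorIso σ σ' ≪≫ tensorComp q g q' g'

/-- The canonical square `f ≫ 𝟙 ≅ 𝟙 ≫ f`. -/
def idSq {X Y : 𝓜} (f : X ⟶ Y) : f ≫ 𝟙 Y ≅ 𝟙 X ≫ f := ρ_ f ≪≫ (λ_ f).symm

def preLeft {X Y Z X' Y' : 𝓜} (f : X ⟶ Y) (g : Y ⟶ Z) (h : X' ⟶ Y') :
    (f ⊠₁ 𝟙 X') ≫ (g ⊠₁ h) ≅ (f ≫ g) ⊠₁ h :=
  (tensorComp f g (𝟙 X') h).symm ≪≫ tensorIso (Iso.refl _) (λ_ h)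

def postLeft {X Y Z X' Y' : 𝓜} (f : X ⟶ Y) (g : Y ⟶ Z) (h : X' ⟶ Y') :
    (f ⊠₁ h) ≫ (g ⊠₁ 𝟙 Y') ≅ (f ≫ g) ⊠₁ h :=
  (tensorComp f g h (𝟙 Y')).symm ≪≫ tensorIso (Iso.refl _) (ρ_ h)

def preRight {X Y X' Y' Z' : 𝓜} (h : X ⟶ Y) (f : X' ⟶ Y') (g : Y' ⟶ Z') :
    (𝟙 X ⊠₁ f) ≫ (h ⊠₁ g) ≅ h ⊠₁ (f ≫ g) :=
  (tensorComp (𝟙 X) h f g).symm ≪≫ tensorIso (λ_ h) (Iso.refl _)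

def postRight {X Y X' Y' Z' : 𝓜} (h : X ⟶ Y) (f : X' ⟶ Y') (g : Y' ⟶ Z') :
    (h ⊠₁ f) ≫ (𝟙 Y ⊠₁ g) ≅ h ⊠₁ (f ≫ g) :=
  (tensorComp h (𝟙 Y) f g).symm ≪≫ tensorIso (ρ_ h) (Iso.refl _)

def tensorLR {X Y X' Y' : 𝓜} (f : X ⟶ Y) (g : X' ⟶ Y') :
    (f ⊠₁ 𝟙 X') ≫ (𝟙 Y ⊠₁ g) ≅ f ⊠₁ g :=
  (tensorComp f (𝟙 Y) (𝟙 X') g).symm ≪≫ tensorIso (ρ_ f) (λ_ g)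

def tensorRL {X Y X' Y' : 𝓜} (f : X ⟶ Y) (g : X' ⟶ Y') :
    (𝟙 X ⊠₁ g) ≫ (f ⊠₁ 𝟙 Y') ≅ f ⊠₁ g :=
  (tensorComp (𝟙 X) f g (𝟙 Y')).symm ≪≫ tensorIso (λ_ f) (ρ_ g)

/-- The interchange isomorphism of an arrow in the first and an arrow in the second variable. -/
def exch {X Y X' Y' : 𝓜} (f : X ⟶ Y) (g : X' ⟶ Y') :
    (f ⊠₁ 𝟙 X') ≫ (𝟙 Y ⊠₁ g) ≅ (𝟙 X ⊠₁ g) ≫ (f ⊠₁ 𝟙 Y') :=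
  tensorLR f g ≪≫ (tensorRL f g).symm

def tripleLeft (X : 𝓜) {X₀ X₁ X₂ X₃ : 𝓜} (f : X₀ ⟶ X₁) (g : X₁ ⟶ X₂) (h : X₂ ⟶ X₃) :
    (𝟙 X ⊠₁ f) ≫ (𝟙 X ⊠₁ g) ≫ (𝟙 X ⊠₁ h) ≅ 𝟙 X ⊠₁ (f ≫ g ≫ h) :=
  whiskerLeftIso _ (preRight (𝟙 X) g h) ≪≫ preRight (𝟙 X) f (g ≫ h)

def tripleRight {X₀ X₁ X₂ X₃ : 𝓜} (f : X₀ ⟶ X₁) (g : X₁ ⟶ X₂) (h : X₂ ⟶ X₃) (X : 𝓜) :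
    (f ⊠₁ 𝟙 X) ≫ (g ⊠₁ 𝟙 X) ≫ (h ⊠₁ 𝟙 X) ≅ (f ≫ g ≫ h) ⊠₁ 𝟙 X :=
  whiskerLeftIso _ (preLeft g h (𝟙 X)) ≪≫ preLeft f (g ≫ h) (𝟙 X)

end TensorBicategory

open TensorBicategory

/-- A tensor pseudofunctor with a unit object and with pseudonatural adjoint equivalences for
associativity and for the two unit laws. -/
class UnitalTensorBicategory (𝓜 : Type u) [Bicategory.{w, v} 𝓜] extends TensorBicategory 𝓜 where
  tensorUnit : 𝓜
  assocEquiv (X Y Z : 𝓜) : (X ⊠ Y) ⊠ Z ≌ X ⊠ (Y ⊠ Z)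
  leftUnitEquiv (X : 𝓜) : tensorUnit ⊠ X ≌ X
  rightUnitEquiv (X : 𝓜) : X ⊠ tensorUnit ≌ X
  assocNat {X Y Z X' Y' Z' : 𝓜} (f : X ⟶ X') (g : Y ⟶ Y') (h : Z ⟶ Z') :
    ((f ⊠₁ g) ⊠₁ h) ≫ (assocEquiv X' Y' Z').hom ≅ (assocEquiv X Y Z).hom ≫ (f ⊠₁ (g ⊠₁ h))
  assocNat_cell {X Y Z X' Y' Z' : 𝓜} {f f' : X ⟶ X'} {g g' : Y ⟶ Y'} {h h' : Z ⟶ Z'}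
    (η : f ⟶ f') (θ : g ⟶ g') (κ : h ⟶ h') :
    ((η ⊠₂ θ) ⊠₂ κ) ▷ (assocEquiv X' Y' Z').hom ≫ (assocNat f' g' h').hom =
      (assocNat f g h).hom ≫ (assocEquiv X Y Z).hom ◁ (η ⊠₂ (θ ⊠₂ κ))
  assocNat_id (X Y Z : 𝓜) :
    (assocNat (𝟙 X) (𝟙 Y) (𝟙 Z)).hom ≫
        (assocEquiv X Y Z).hom ◁ ((𝟙 (𝟙 X) ⊠₂ (tensorId Y Z).hom) ≫ (tensorId X (Y ⊠ Z)).hom) =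
      (((tensorId X Y).hom ⊠₂ 𝟙 (𝟙 Z)) ≫ (tensorId (X ⊠ Y) Z).hom) ▷ (assocEquiv X Y Z).hom ≫
        (λ_ _).hom ≫ (ρ_ _).inv
  assocNat_comp {X Y Z X' Y' Z' X'' Y'' Z'' : 𝓜} (f : X ⟶ X') (f' : X' ⟶ X'')
    (g : Y ⟶ Y') (g' : Y' ⟶ Y'') (h : Z ⟶ Z') (h' : Z' ⟶ Z'') :
    (assocNat (f ≫ f') (g ≫ g') (h ≫ h')).hom ≫
        (assocEquiv X Y Z).hom ◁ ((𝟙 (f ≫ f') ⊠₂ (tensorComp g g' h h').hom) ≫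
          (tensorComp f f' (g ⊠₁ h) (g' ⊠₁ h')).hom) =
      (((tensorComp f f' g g').hom ⊠₂ 𝟙 (h ≫ h')) ≫
          (tensorComp (f ⊠₁ g) (f' ⊠₁ g') h h').hom) ▷ (assocEquiv X'' Y'' Z'').hom ≫
        (α_ _ _ _).hom ≫ ((f ⊠₁ g) ⊠₁ h) ◁ (assocNat f' g' h').hom ≫
        (α_ _ _ _).inv ≫ (assocNat f g h).hom ▷ (f' ⊠₁ (g' ⊠₁ h')) ≫ (α_ _ _ _).hom
  leftUnitNat {X Y : 𝓜} (f : X ⟶ Y) :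
    (𝟙 tensorUnit ⊠₁ f) ≫ (leftUnitEquiv Y).hom ≅ (leftUnitEquiv X).hom ≫ f
  leftUnitNat_cell {X Y : 𝓜} {f g : X ⟶ Y} (η : f ⟶ g) :
    (𝟙 (𝟙 tensorUnit) ⊠₂ η) ▷ (leftUnitEquiv Y).hom ≫ (leftUnitNat g).hom =
      (leftUnitNat f).hom ≫ (leftUnitEquiv X).hom ◁ η
  leftUnitNat_id (X : 𝓜) :
    (leftUnitNat (𝟙 X)).hom =
      (tensorId tensorUnit X).hom ▷ (leftUnitEquiv X).hom ≫ (λ_ _).hom ≫ (ρ_ _).inv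
  leftUnitNat_comp {X Y Z : 𝓜} (f : X ⟶ Y) (g : Y ⟶ Z) :
    (leftUnitNat (f ≫ g)).hom =
      (preRight (𝟙 tensorUnit) f g).inv ▷ (leftUnitEquiv Z).hom ≫ (α_ _ _ _).hom ≫
        (𝟙 tensorUnit ⊠₁ f) ◁ (leftUnitNat g).hom ≫ (α_ _ _ _).inv ≫
        (leftUnitNat f).hom ▷ g ≫ (α_ _ _ _).hom
  rightUnitNat {X Y : 𝓜} (f : X ⟶ Y) :
    (f ⊠₁ 𝟙 tensorUnit) ≫ (rightUnitEquiv Y).hom ≅ (rightUnitEquiv X).hom ≫ f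
  rightUnitNat_cell {X Y : 𝓜} {f g : X ⟶ Y} (η : f ⟶ g) :
    (η ⊠₂ 𝟙 (𝟙 tensorUnit)) ▷ (rightUnitEquiv Y).hom ≫ (rightUnitNat g).hom =
      (rightUnitNat f).hom ≫ (rightUnitEquiv X).hom ◁ η
  rightUnitNat_id (X : 𝓜) :
    (rightUnitNat (𝟙 X)).hom =
      (tensorId X tensorUnit).hom ▷ (rightUnitEquiv X).hom ≫ (λ_ _).hom ≫ (ρ_ _).inv
  rightUnitNat_comp {X Y Z : 𝓜} (f : X ⟶ Y) (g : Y ⟶ Z) :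
    (rightUnitNat (f ≫ g)).hom =
      (preLeft f g (𝟙 tensorUnit)).inv ▷ (rightUnitEquiv Z).hom ≫ (α_ _ _ _).hom ≫
        (f ⊠₁ 𝟙 tensorUnit) ◁ (rightUnitNat g).hom ≫ (α_ _ _ _).inv ≫
        (rightUnitNat f).hom ▷ g ≫ (α_ _ _ _).hom

namespace UnitalTensorBicategory

section

variable {𝓜 : Type u} [Bicategory.{w, v} 𝓜] [UnitalTensorBicategory 𝓜]

/-- The associativity arrow `(XY)Z ⟶ X(YZ)`. -/
abbrev as (X Y Z : 𝓜) : (X ⊠ Y) ⊠ Z ⟶ X ⊠ (Y ⊠ Z) := (assocEquiv X Y Z).hom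

/-- The chosen adjoint inverse `X(YZ) ⟶ (XY)Z` of the associativity arrow. -/
abbrev asInv (X Y Z : 𝓜) : X ⊠ (Y ⊠ Z) ⟶ (X ⊠ Y) ⊠ Z := (assocEquiv X Y Z).inv

/-- The left unit arrow `IX ⟶ X`. -/
abbrev lu (X : 𝓜) : tensorUnit ⊠ X ⟶ X := (leftUnitEquiv X).hom

/-- The right unit arrow `XI ⟶ X`. -/
abbrev ru (X : 𝓜) : X ⊠ tensorUnit ⟶ X := (rightUnitEquiv X).hom

def assocNatLeft {X X' : 𝓜} (f : X ⟶ X') (Y Z : 𝓜) :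
    ((f ⊠₁ 𝟙 Y) ⊠₁ 𝟙 Z) ≫ as X' Y Z ≅ as X Y Z ≫ (f ⊠₁ 𝟙 (Y ⊠ Z)) :=
  assocNat f (𝟙 Y) (𝟙 Z) ≪≫ whiskerLeftIso _ (tensorIso (Iso.refl f) (tensorId Y Z))

def assocNatMid (X : 𝓜) {Y Y' : 𝓜} (f : Y ⟶ Y') (Z : 𝓜) :
    ((𝟙 X ⊠₁ f) ⊠₁ 𝟙 Z) ≫ as X Y' Z ≅ as X Y Z ≫ (𝟙 X ⊠₁ (f ⊠₁ 𝟙 Z)) :=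
  assocNat (𝟙 X) f (𝟙 Z)

def assocNatRight (X Y : 𝓜) {Z Z' : 𝓜} (f : Z ⟶ Z') :
    (𝟙 (X ⊠ Y) ⊠₁ f) ≫ as X Y Z' ≅ as X Y Z ≫ (𝟙 X ⊠₁ (𝟙 Y ⊠₁ f)) :=
  whiskerRightIso (tensorIso (tensorId X Y).symm (Iso.refl f)) _ ≪≫ assocNat (𝟙 X) (𝟙 Y) f

end

end UnitalTensorBicategory

open UnitalTensorBicategory

/-- A monoidal bicategory (a tricategory with one object). -/
class MonoidalBicategory (𝓜 : Type u) [Bicategory.{w, v} 𝓜] extends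
    UnitalTensorBicategory 𝓜 where
  pentagonator (X Y Z W : 𝓜) :
    (as X Y Z ⊠₁ 𝟙 W) ≫ as X (Y ⊠ Z) W ≫ (𝟙 X ⊠₁ as Y Z W) ≅
      as (X ⊠ Y) Z W ≫ as X Y (Z ⊠ W)
  leftUnitMod (X Y : 𝓜) : lu X ⊠₁ 𝟙 Y ≅ as tensorUnit X Y ≫ lu (X ⊠ Y)
  midUnitMod (X Y : 𝓜) : ru X ⊠₁ 𝟙 Y ≅ as X tensorUnit Y ≫ (𝟙 X ⊠₁ lu Y)
  rightUnitMod (X Y : 𝓜) : ru (X ⊠ Y) ≅ as X Y tensorUnit ≫ (𝟙 X ⊠₁ ru Y)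
  /-- the pentagonator is a modification -/
  pentagonator_natural {X Y Z W X' Y' Z' W' : 𝓜}
    (f : X ⟶ X') (g : Y ⟶ Y') (h : Z ⟶ Z') (k : W ⟶ W') :
    (((f ⊠₁ g) ⊠₁ h) ⊠₁ k) ◁ (pentagonator X' Y' Z' W').hom ⊗≫
        (assocNat (f ⊠₁ g) h k).hom ▷ as X' Y' (Z' ⊠ W') ⊗≫
        as (X ⊠ Y) Z W ◁ (assocNat f g (h ⊠₁ k)).hom ⊗≫
        𝟙 (as (X ⊠ Y) Z W ≫ as X Y (Z ⊠ W) ≫ (f ⊠₁ (g ⊠₁ (h ⊠₁ k)))) =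
      𝟙 ((((f ⊠₁ g) ⊠₁ h) ⊠₁ k) ≫
          (as X' Y' Z' ⊠₁ 𝟙 W') ≫ as X' (Y' ⊠ Z') W' ≫ (𝟙 X' ⊠₁ as Y' Z' W')) ⊗≫
        (tensorSq (assocNat f g h) (idSq k)).hom ▷
          (as X' (Y' ⊠ Z') W' ≫ (𝟙 X' ⊠₁ as Y' Z' W')) ⊗≫
        (as X Y Z ⊠₁ 𝟙 W) ◁ (assocNat f (g ⊠₁ h) k).hom ▷ (𝟙 X' ⊠₁ as Y' Z' W') ⊗≫
        ((as X Y Z ⊠₁ 𝟙 W) ≫ as X (Y ⊠ Z) W) ◁ (tensorSq (idSq f) (assocNat g h k)).hom ⊗≫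
        (pentagonator X Y Z W).hom ▷ (f ⊠₁ (g ⊠₁ (h ⊠₁ k))) ⊗≫
        𝟙 (as (X ⊠ Y) Z W ≫ as X Y (Z ⊠ W) ≫ (f ⊠₁ (g ⊠₁ (h ⊠₁ k))))
  leftUnitMod_natural {X Y X' Y' : 𝓜} (f : X ⟶ X') (g : Y ⟶ Y') :
    ((𝟙 tensorUnit ⊠₁ f) ⊠₁ g) ◁ (leftUnitMod X' Y').hom ⊗≫
        (assocNat (𝟙 tensorUnit) f g).hom ▷ lu (X' ⊠ Y') ⊗≫
        as tensorUnit X Y ◁ (leftUnitNat (f ⊠₁ g)).hom =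
      (tensorSq (leftUnitNat f) (idSq g)).hom ⊗≫
        (leftUnitMod X Y).hom ▷ (f ⊠₁ g) ⊗≫ 𝟙 (as tensorUnit X Y ≫ lu (X ⊠ Y) ≫ (f ⊠₁ g))
  midUnitMod_natural {X Y X' Y' : 𝓜} (f : X ⟶ X') (g : Y ⟶ Y') :
    ((f ⊠₁ 𝟙 tensorUnit) ⊠₁ g) ◁ (midUnitMod X' Y').hom ⊗≫
        (assocNat f (𝟙 tensorUnit) g).hom ▷ (𝟙 X' ⊠₁ lu Y') ⊗≫
        as X tensorUnit Y ◁ (tensorSq (idSq f) (leftUnitNat g)).hom =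
      (tensorSq (rightUnitNat f) (idSq g)).hom ⊗≫
        (midUnitMod X Y).hom ▷ (f ⊠₁ g) ⊗≫
        𝟙 (as X tensorUnit Y ≫ (𝟙 X ⊠₁ lu Y) ≫ (f ⊠₁ g))
  rightUnitMod_natural {X Y X' Y' : 𝓜} (f : X ⟶ X') (g : Y ⟶ Y') :
    ((f ⊠₁ g) ⊠₁ 𝟙 tensorUnit) ◁ (rightUnitMod X' Y').hom ⊗≫
        (assocNat f g (𝟙 tensorUnit)).hom ▷ (𝟙 X' ⊠₁ ru Y') ⊗≫
        as X Y tensorUnit ◁ (tensorSq (idSq f) (rightUnitNat g)).hom =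
      (rightUnitNat (f ⊠₁ g)).hom ⊗≫
        (rightUnitMod X Y).hom ▷ (f ⊠₁ g) ⊗≫
        𝟙 (as X Y tensorUnit ≫ (𝟙 X ⊠₁ ru Y) ≫ (f ⊠₁ g))
  /-- the associativity axiom (nonabelian 4-cocycle condition): the two pastings in the
  associahedron on five objects agree -/
  cocycle (A B C D E : 𝓜) :
    𝟙 (((as A B C ⊠₁ 𝟙 D) ⊠₁ 𝟙 E) ≫ (as A (B ⊠ C) D ⊠₁ 𝟙 E) ≫
          ((𝟙 A ⊠₁ as B C D) ⊠₁ 𝟙 E) ≫ as A (B ⊠ (C ⊠ D)) E ≫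
          (𝟙 A ⊠₁ as B (C ⊠ D) E) ≫ (𝟙 A ⊠₁ (𝟙 B ⊠₁ as C D E))) ⊗≫
        ((tripleRight _ _ _ E).hom ≫ ((pentagonator A B C D).hom ⊠₂ 𝟙 (𝟙 E)) ≫
            (preLeft _ _ (𝟙 E)).inv) ▷
          (as A (B ⊠ (C ⊠ D)) E ≫ (𝟙 A ⊠₁ as B (C ⊠ D) E) ≫
            (𝟙 A ⊠₁ (𝟙 B ⊠₁ as C D E))) ⊗≫
        (as (A ⊠ B) C D ⊠₁ 𝟙 E) ◁ (pentagonator A B (C ⊠ D) E).hom ▷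
          (𝟙 A ⊠₁ (𝟙 B ⊠₁ as C D E)) ⊗≫
        ((as (A ⊠ B) C D ⊠₁ 𝟙 E) ≫ as (A ⊠ B) (C ⊠ D) E) ◁
          (assocNatRight A B (as C D E)).inv ⊗≫
        (pentagonator (A ⊠ B) C D E).hom ▷ as A B (C ⊠ (D ⊠ E)) ⊗≫
        𝟙 (as ((A ⊠ B) ⊠ C) D E ≫ as (A ⊠ B) C (D ⊠ E) ≫ as A B (C ⊠ (D ⊠ E))) =
      𝟙 (((as A B C ⊠₁ 𝟙 D) ⊠₁ 𝟙 E) ≫ (as A (B ⊠ C) D ⊠₁ 𝟙 E) ≫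
          ((𝟙 A ⊠₁ as B C D) ⊠₁ 𝟙 E) ≫ as A (B ⊠ (C ⊠ D)) E ≫
          (𝟙 A ⊠₁ as B (C ⊠ D) E) ≫ (𝟙 A ⊠₁ (𝟙 B ⊠₁ as C D E))) ⊗≫
        (((as A B C ⊠₁ 𝟙 D) ⊠₁ 𝟙 E) ≫ (as A (B ⊠ C) D ⊠₁ 𝟙 E)) ◁
          (assocNatMid A (as B C D) E).hom ▷
          ((𝟙 A ⊠₁ as B (C ⊠ D) E) ≫ (𝟙 A ⊠₁ (𝟙 B ⊠₁ as C D E))) ⊗≫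
        (((as A B C ⊠₁ 𝟙 D) ⊠₁ 𝟙 E) ≫ (as A (B ⊠ C) D ⊠₁ 𝟙 E) ≫ as A ((B ⊠ C) ⊠ D) E) ◁
          ((tripleLeft A _ _ _).hom ≫ (𝟙 (𝟙 A) ⊠₂ (pentagonator B C D E).hom) ≫
            (preRight (𝟙 A) _ _).inv) ⊗≫
        ((as A B C ⊠₁ 𝟙 D) ⊠₁ 𝟙 E) ◁ (pentagonator A (B ⊠ C) D E).hom ▷
          (𝟙 A ⊠₁ as B C (D ⊠ E)) ⊗≫
        (assocNatLeft (as A B C) D E).hom ▷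
          (as A (B ⊠ C) (D ⊠ E) ≫ (𝟙 A ⊠₁ as B C (D ⊠ E))) ⊗≫
        as ((A ⊠ B) ⊠ C) D E ◁ (pentagonator A B C (D ⊠ E)).hom
  /-- the first unit axiom -/
  unit_axiom_left (X Y Z : 𝓜) :
    𝟙 (((ru X ⊠₁ 𝟙 Y) ⊠₁ 𝟙 Z) ≫ as X Y Z) ⊗≫
        (assocNatLeft (ru X) Y Z).hom ⊗≫
        as (X ⊠ tensorUnit) Y Z ◁ (midUnitMod X (Y ⊠ Z)).hom =
      𝟙 (((ru X ⊠₁ 𝟙 Y) ⊠₁ 𝟙 Z) ≫ as X Y Z) ⊗≫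
        (((midUnitMod X Y).hom ⊠₂ 𝟙 (𝟙 Z)) ≫ (preLeft _ _ (𝟙 Z)).inv) ▷ as X Y Z ⊗≫
        (as X tensorUnit Y ⊠₁ 𝟙 Z) ◁ (assocNatMid X (lu Y) Z).hom ⊗≫
        ((as X tensorUnit Y ⊠₁ 𝟙 Z) ≫ as X (tensorUnit ⊠ Y) Z) ◁
          ((𝟙 (𝟙 X) ⊠₂ (leftUnitMod Y Z).hom) ≫ (preRight (𝟙 X) _ _).inv) ⊗≫
        (pentagonator X tensorUnit Y Z).hom ▷ (𝟙 X ⊠₁ lu (Y ⊠ Z)) ⊗≫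
        𝟙 (as (X ⊠ tensorUnit) Y Z ≫ as X tensorUnit (Y ⊠ Z) ≫ (𝟙 X ⊠₁ lu (Y ⊠ Z)))
  /-- the second unit axiom -/
  unit_axiom_right (X Y Z : 𝓜) :
    𝟙 ((ru (X ⊠ Y) ⊠₁ 𝟙 Z) ≫ as X Y Z) ⊗≫
        (midUnitMod (X ⊠ Y) Z).hom ▷ as X Y Z ⊗≫
        as (X ⊠ Y) tensorUnit Z ◁ (assocNatRight X Y (lu Z)).hom =
      𝟙 ((ru (X ⊠ Y) ⊠₁ 𝟙 Z) ≫ as X Y Z) ⊗≫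
        (((rightUnitMod X Y).hom ⊠₂ 𝟙 (𝟙 Z)) ≫ (preLeft _ _ (𝟙 Z)).inv) ▷ as X Y Z ⊗≫
        (as X Y tensorUnit ⊠₁ 𝟙 Z) ◁ (assocNatMid X (ru Y) Z).hom ⊗≫
        ((as X Y tensorUnit ⊠₁ 𝟙 Z) ≫ as X (Y ⊠ tensorUnit) Z) ◁
          ((𝟙 (𝟙 X) ⊠₂ (midUnitMod Y Z).hom) ≫ (preRight (𝟙 X) _ _).inv) ⊗≫
        (pentagonator X Y tensorUnit Z).hom ▷ (𝟙 X ⊠₁ (𝟙 Y ⊠₁ lu Z)) ⊗≫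
        𝟙 (as (X ⊠ Y) tensorUnit Z ≫ as X Y (tensorUnit ⊠ Z) ≫ (𝟙 X ⊠₁ (𝟙 Y ⊠₁ lu Z)))

namespace MonoidalBicategory

variable {𝓜 : Type u} [Bicategory.{w, v} 𝓜] [MonoidalBicategory 𝓜]

/-! ### Coherence cells

Canonical invertible cells that the coherence theorem for monoidal bicategories suppresses. -/

/-- A square along the forward arrows of two adjoint equivalences gives one along the inverses. -/
def invSquare {X X' Y Y' : 𝓜} (e : X ≌ X') (e' : Y ≌ Y') {F : X ⟶ Y} {G : X' ⟶ Y'}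
    (s : F ≫ e'.hom ≅ e.hom ≫ G) : G ≫ e'.inv ≅ e.inv ≫ F :=
  (λ_ (G ≫ e'.inv)).symm ≪≫ whiskerRightIso e.counit.symm (G ≫ e'.inv) ≪⊗≫
    whiskerLeftIso e.inv (whiskerRightIso s.symm e'.inv) ≪⊗≫
    whiskerLeftIso (e.inv ≫ F) e'.unit.symm ≪≫ ρ_ (e.inv ≫ F)

/-- `l_{IX} ≅ 1 ⊗ l_X`, obtained from naturality of `l` by cancelling `l_X`. -/
def leftUnitCancel (X : 𝓜) : lu (tensorUnit ⊠ X) ≅ 𝟙 tensorUnit ⊠₁ lu X :=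
  (ρ_ (lu (tensorUnit ⊠ X))).symm ≪≫
    whiskerLeftIso (lu (tensorUnit ⊠ X)) (leftUnitEquiv X).unit ≪⊗≫
    whiskerRightIso (leftUnitNat (lu X)).symm (leftUnitEquiv X).inv ≪⊗≫
    whiskerLeftIso (𝟙 tensorUnit ⊠₁ lu X) (leftUnitEquiv X).unit.symm ≪≫
    ρ_ (𝟙 tensorUnit ⊠₁ lu X)

/-- `f ≅ r⁻¹ ≫ (f ⊗ 1) ≫ r` for arrows `f`. -/
def rightUnitConj {X Y : 𝓜} (f : X ⟶ Y) :
    f ≅ (rightUnitEquiv X).inv ≫ (f ⊠₁ 𝟙 tensorUnit) ≫ ru Y :=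
  (λ_ f).symm ≪≫ whiskerRightIso (rightUnitEquiv X).counit.symm f ≪⊗≫
    whiskerLeftIso (rightUnitEquiv X).inv (rightUnitNat f).symm

/-- The canonical isomorphism `l_I ≅ r_I`. -/
def unitIso : lu (tensorUnit : 𝓜) ≅ ru (tensorUnit : 𝓜) :=
  rightUnitConj (lu tensorUnit) ≪≫
    whiskerLeftIso (rightUnitEquiv (tensorUnit ⊠ tensorUnit)).inv (whiskerRightIso
      (leftUnitMod tensorUnit tensorUnit ≪≫
        whiskerLeftIso (as tensorUnit tensorUnit tensorUnit) (leftUnitCancel tensorUnit) ≪≫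
        (midUnitMod tensorUnit tensorUnit).symm) (ru tensorUnit)) ≪≫
    (rightUnitConj (ru tensorUnit)).symm

/-- `α ≫ (1 ⊗ α) ≫ α⁻¹ ≅ (α⁻¹ ⊗ 1) ≫ α`. -/
def pentagonInvLeft (X Y Z W : 𝓜) :
    as X (Y ⊠ Z) W ≫ (𝟙 X ⊠₁ as Y Z W) ≫ asInv X Y (Z ⊠ W) ≅
      (asInv X Y Z ⊠₁ 𝟙 W) ≫ as (X ⊠ Y) Z W :=
  (λ_ _).symm ≪≫
    whiskerRightIso ((tensorId _ W).symm ≪≫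
      tensorIso (assocEquiv X Y Z).counit.symm (Iso.refl (𝟙 W)) ≪≫
      (preLeft (asInv X Y Z) (as X Y Z) (𝟙 W)).symm)
      (as X (Y ⊠ Z) W ≫ (𝟙 X ⊠₁ as Y Z W) ≫ asInv X Y (Z ⊠ W)) ≪⊗≫
    whiskerLeftIso (asInv X Y Z ⊠₁ 𝟙 W)
      (whiskerRightIso (pentagonator X Y Z W) (asInv X Y (Z ⊠ W))) ≪⊗≫
    whiskerLeftIso ((asInv X Y Z ⊠₁ 𝟙 W) ≫ as (X ⊠ Y) Z W)
      (assocEquiv X Y (Z ⊠ W)).unit.symm ≪≫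
    ρ_ ((asInv X Y Z ⊠₁ 𝟙 W) ≫ as (X ⊠ Y) Z W)

/-- `α⁻¹ ≫ (α ⊗ 1) ≫ α ≅ α ≫ (1 ⊗ α⁻¹)`. -/
def pentagonInvRight (X Y Z W : 𝓜) :
    asInv (X ⊠ Y) Z W ≫ (as X Y Z ⊠₁ 𝟙 W) ≫ as X (Y ⊠ Z) W ≅
      as X Y (Z ⊠ W) ≫ (𝟙 X ⊠₁ asInv Y Z W) :=
  (ρ_ _).symm ≪≫
    whiskerLeftIso (asInv (X ⊠ Y) Z W ≫ (as X Y Z ⊠₁ 𝟙 W) ≫ as X (Y ⊠ Z) W)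
      ((tensorId X _).symm ≪≫
        tensorIso (Iso.refl (𝟙 X)) (assocEquiv Y Z W).unit ≪≫
        (preRight (𝟙 X) (as Y Z W) (asInv Y Z W)).symm) ≪⊗≫
    whiskerLeftIso (asInv (X ⊠ Y) Z W)
      (whiskerRightIso (pentagonator X Y Z W) (𝟙 X ⊠₁ asInv Y Z W)) ≪⊗≫
    whiskerRightIso (assocEquiv (X ⊠ Y) Z W).counit
      (as X Y (Z ⊠ W) ≫ (𝟙 X ⊠₁ asInv Y Z W)) ≪≫
    λ_ (as X Y (Z ⊠ W) ≫ (𝟙 X ⊠₁ asInv Y Z W))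

/-! ### Skew monoidales and oplax actions -/

/-- A product arrow and a unit arrow on an object. -/
structure ProductUnit (M : 𝓜) where
  m : M ⊠ M ⟶ M
  u : tensorUnit ⟶ M

/-- The data of an oplax right `M`-action on `A`: an arrow `a : AM ⟶ A`, an associator cell
`a² : a(1m) ⟶ a(a1)` and a right unitor cell `a⁰ : a(1u) ⟶ 1`. -/
structure ActionData {M : 𝓜} (p : ProductUnit M) (A : 𝓜) where
  a : A ⊠ M ⟶ A
  a2 : as A M M ≫ (𝟙 A ⊠₁ p.m) ≫ a ⟶ (a ⊠₁ 𝟙 M) ≫ a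
  a0 : (𝟙 A ⊠₁ p.u) ≫ a ⟶ ru A

/-- The data of a right skew monoidale on `M`: product and unit arrows, an associator cell
`α : m(1m) ⟶ m(m1)`, a left unitor cell `λ : 1 ⟶ m(u1)` and a right unitor cell
`ρ : m(1u) ⟶ 1`. -/
structure SkewMonoidaleData (M : 𝓜) extends ProductUnit M where
  assocCell : as M M M ≫ (𝟙 M ⊠₁ m) ≫ m ⟶ (m ⊠₁ 𝟙 M) ≫ m
  leftCell : lu M ⟶ (u ⊠₁ 𝟙 M) ≫ m
  rightCell : (𝟙 M ⊠₁ u) ≫ m ⟶ ru M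

/-- The regular action data of `M` on itself, given by `m`, `α` and `ρ`. -/
abbrev SkewMonoidaleData.regular {M : 𝓜} (S : SkewMonoidaleData M) :
    ActionData S.toProductUnit M where
  a := S.m
  a2 := S.assocCell
  a0 := S.rightCell

section ActionAxioms

variable {M : 𝓜} (S : SkewMonoidaleData M) {A : 𝓜} (a : ActionData S.toProductUnit A)

/-- The pentagon law for an oplax action: an equality of two cells
`a (1m) (11m) ⟶ a (a1) (a11)`. -/
def ActionPentagon : Prop :=
  𝟙 (as (A ⊠ M) M M ≫ as A M (M ⊠ M) ≫ (𝟙 A ⊠₁ (𝟙 M ⊠₁ S.m)) ≫ (𝟙 A ⊠₁ S.m) ≫ a.a) ⊗≫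
      (pentagonator A M M M).inv ▷
        ((𝟙 A ⊠₁ (𝟙 M ⊠₁ S.m)) ≫ (𝟙 A ⊠₁ S.m) ≫ a.a) ⊗≫
      ((as A M M ⊠₁ 𝟙 M) ≫ as A (M ⊠ M) M) ◁
        ((tripleLeft A _ _ _).hom ≫ (𝟙 (𝟙 A) ⊠₂ S.assocCell) ≫
          (preRight (𝟙 A) _ _).inv) ▷ a.a ⊗≫
      (as A M M ⊠₁ 𝟙 M) ◁ (assocNatMid A S.m M).inv ▷ ((𝟙 A ⊠₁ S.m) ≫ a.a) ⊗≫
      ((as A M M ⊠₁ 𝟙 M) ≫ ((𝟙 A ⊠₁ S.m) ⊠₁ 𝟙 M)) ◁ a.a2 ⊗≫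
      ((tripleRight _ _ _ M).hom ≫ (a.a2 ⊠₂ 𝟙 (𝟙 M)) ≫ (preLeft _ _ (𝟙 M)).inv) ▷ a.a ⊗≫
      𝟙 (((a.a ⊠₁ 𝟙 M) ⊠₁ 𝟙 M) ≫ (a.a ⊠₁ 𝟙 M) ≫ a.a) =
    𝟙 (as (A ⊠ M) M M ≫ as A M (M ⊠ M) ≫ (𝟙 A ⊠₁ (𝟙 M ⊠₁ S.m)) ≫ (𝟙 A ⊠₁ S.m) ≫ a.a) ⊗≫
      as (A ⊠ M) M M ◁ (assocNatRight A M S.m).inv ▷ ((𝟙 A ⊠₁ S.m) ≫ a.a) ⊗≫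
      (as (A ⊠ M) M M ≫ (𝟙 (A ⊠ M) ⊠₁ S.m)) ◁ a.a2 ⊗≫
      as (A ⊠ M) M M ◁ (exch a.a S.m).inv ▷ a.a ⊗≫
      (assocNatLeft a.a M M).inv ▷ ((𝟙 A ⊠₁ S.m) ≫ a.a) ⊗≫
      ((a.a ⊠₁ 𝟙 M) ⊠₁ 𝟙 M) ◁ a.a2

/-- The right unit law for an oplax action: an equality of two cells `a (1m) (11u) ⟶ a`. -/
def ActionRightUnit : Prop :=
  𝟙 ((𝟙 (A ⊠ M) ⊠₁ S.u) ≫ as A M M ≫ (𝟙 A ⊠₁ S.m) ≫ a.a) ⊗≫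
      (assocNatRight A M S.u).hom ▷ ((𝟙 A ⊠₁ S.m) ≫ a.a) ⊗≫
      as A M tensorUnit ◁ ((preRight (𝟙 A) _ _).hom ≫ (𝟙 (𝟙 A) ⊠₂ S.rightCell)) ▷ a.a ⊗≫
      (rightUnitMod A M).inv ▷ a.a =
    𝟙 ((𝟙 (A ⊠ M) ⊠₁ S.u) ≫ as A M M ≫ (𝟙 A ⊠₁ S.m) ≫ a.a) ⊗≫
      (𝟙 (A ⊠ M) ⊠₁ S.u) ◁ a.a2 ⊗≫
      (exch a.a S.u).inv ▷ a.a ⊗≫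
      (a.a ⊠₁ 𝟙 tensorUnit) ◁ a.a0 ⊗≫
      (rightUnitNat a.a).hom

/-- The middle unit law for an oplax action: a cell `a ⟶ a` is the identity. -/
def ActionMiddleUnit : Prop :=
  𝟙 ((ru A ⊠₁ 𝟙 M) ≫ a.a) ⊗≫
      (midUnitMod A M).hom ▷ a.a ⊗≫
      as A tensorUnit M ◁ ((𝟙 (𝟙 A) ⊠₂ S.leftCell) ≫ (preRight (𝟙 A) _ _).inv) ▷ a.a ⊗≫
      (assocNatMid A S.u M).inv ▷ ((𝟙 A ⊠₁ S.m) ≫ a.a) ⊗≫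
      ((𝟙 A ⊠₁ S.u) ⊠₁ 𝟙 M) ◁ a.a2 ⊗≫
      ((preLeft _ _ (𝟙 M)).hom ≫ (a.a0 ⊠₂ 𝟙 (𝟙 M))) ▷ a.a =
    𝟙 ((ru A ⊠₁ 𝟙 M) ≫ a.a)

end ActionAxioms

/-- The left unit law of a skew monoidale: an equality of two cells `m ⟶ m (m1) (u11)`. -/
def LeftUnitLaw {M : 𝓜} (S : SkewMonoidaleData M) : Prop :=
  𝟙 ((lu M ⊠₁ 𝟙 M) ≫ S.m) ⊗≫
      (leftUnitMod M M).hom ▷ S.m ⊗≫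
      as tensorUnit M M ◁ (leftUnitNat S.m).inv ⊗≫
      (as tensorUnit M M ≫ (𝟙 tensorUnit ⊠₁ S.m)) ◁ S.leftCell ⊗≫
      as tensorUnit M M ◁ (exch S.u S.m).inv ▷ S.m ⊗≫
      (assocNatLeft S.u M M).inv ▷ ((𝟙 M ⊠₁ S.m) ≫ S.m) ⊗≫
      ((S.u ⊠₁ 𝟙 M) ⊠₁ 𝟙 M) ◁ S.assocCell =
    𝟙 ((lu M ⊠₁ 𝟙 M) ≫ S.m) ⊗≫
      ((S.leftCell ⊠₂ 𝟙 (𝟙 M)) ≫ (preLeft _ _ (𝟙 M)).inv) ▷ S.m ⊗≫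
      𝟙 (((S.u ⊠₁ 𝟙 M) ⊠₁ 𝟙 M) ≫ (S.m ⊠₁ 𝟙 M) ≫ S.m)

/-- The unit law of a skew monoidale relating `λ` and `ρ`: the cell
`u ⟶ m (u1) u ≅ m (1u) u ⟶ u` is the identity. -/
def UnitUnitLaw {M : 𝓜} (S : SkewMonoidaleData M) : Prop :=
  (𝟙 tensorUnit ⊠₁ S.u) ◁ S.leftCell ⊗≫
      (exch S.u S.u).inv ▷ S.m ⊗≫
      (S.u ⊠₁ 𝟙 tensorUnit) ◁ S.rightCell ⊗≫
      (rightUnitNat S.u).hom =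
    (leftUnitNat S.u).hom ⊗≫ unitIso.hom ▷ S.u

variable (𝓜) in
/-- A right skew monoidale: its five axioms are the pentagon, the right and the middle unit law
(the laws of an oplax action, for the regular action), the left unit law, and the law relating
the two unitors at the unit. -/
structure RightSkewMonoidale where
  obj : 𝓜
  data : SkewMonoidaleData obj
  pentagon : ActionPentagon data data.regular
  left_unit : LeftUnitLaw data
  middle_unit : ActionMiddleUnit data data.regular
  right_unit : ActionRightUnit data data.regular
  unit_unit : UnitUnitLaw data

/-- An oplax right action of a right skew monoidale `M` on an object `A`. -/
structure OplaxRightAction (M : RightSkewMonoidale 𝓜) (A : 𝓜) where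
  data : ActionData M.data.toProductUnit A
  pentagon : ActionPentagon M.data data
  right_unit : ActionRightUnit M.data data
  middle_unit : ActionMiddleUnit M.data data

/-! ### Comodules and opmonoidal arrows

The notions below mention only the data of the skew monoidales and actions involved. -/

/-- The data of an opmonoidal arrow: `C : M ⟶ N` with cells `C² : C m ⟶ m (CC)` and
`C⁰ : C u ⟶ u`. -/
structure OpmonoidalData {M N : 𝓜} (p : ProductUnit M) (q : ProductUnit N) where
  C : M ⟶ N
  C2 : p.m ≫ C ⟶ (C ⊠₁ C) ≫ q.m
  C0 : p.u ≫ C ⟶ q.u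

section ComoduleAxioms

variable {M N : 𝓜} {p : ProductUnit M} {q : ProductUnit N} {A B : 𝓜}
  (a : ActionData p A) (b : ActionData q B) (C : OpmonoidalData p q) (Y : A ⟶ B)
  (y : a.a ≫ Y ⟶ (Y ⊠₁ C.C) ≫ b.a)

/-- The coassociative law for a coaction: an equality of two cells
`Y a (1m) ⟶ b (b1) (YCC)`. -/
def Coassociative : Prop :=
  𝟙 ((as A M M ≫ (𝟙 A ⊠₁ p.m) ≫ a.a) ≫ Y) ⊗≫
      a.a2 ▷ Y ⊗≫
      (a.a ⊠₁ 𝟙 M) ◁ y ⊗≫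
      ((preLeft a.a Y C.C).hom ≫ (y ⊠₂ 𝟙 C.C) ≫
        (postLeft (Y ⊠₁ C.C) b.a C.C).inv) ▷ b.a ⊗≫
      𝟙 (((Y ⊠₁ C.C) ⊠₁ C.C) ≫ (b.a ⊠₁ 𝟙 N) ≫ b.a) =
    𝟙 ((as A M M ≫ (𝟙 A ⊠₁ p.m) ≫ a.a) ≫ Y) ⊗≫
      (as A M M ≫ (𝟙 A ⊠₁ p.m)) ◁ y ⊗≫
      as A M M ◁ ((preRight Y p.m C.C).hom ≫ (𝟙 Y ⊠₂ C.C2) ≫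
        (postRight Y (C.C ⊠₁ C.C) q.m).inv) ▷ b.a ⊗≫
      (assocNat Y C.C C.C).inv ▷ ((𝟙 B ⊠₁ q.m) ≫ b.a) ⊗≫
      ((Y ⊠₁ C.C) ⊠₁ C.C) ◁ b.a2

/-- The counit law for a coaction: an equality of two cells `Y a (1u) ⟶ Y`. -/
def Counital : Prop :=
  𝟙 ((𝟙 A ⊠₁ p.u) ≫ a.a ≫ Y) ⊗≫ a.a0 ▷ Y =
    (𝟙 A ⊠₁ p.u) ◁ y ⊗≫
      ((preRight Y p.u C.C).hom ≫ (𝟙 Y ⊠₂ C.C0) ≫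
        (tensorLR Y q.u).inv) ▷ b.a ⊗≫
      (Y ⊠₁ 𝟙 tensorUnit) ◁ b.a0 ⊗≫
      (rightUnitNat Y).hom

end ComoduleAxioms

/-- The counit-type law for the left unitors of an opmonoidal arrow: an equality of two cells
`C ⟶ m (u1) C`. -/
def LeftCounital {M N : 𝓜} (S : SkewMonoidaleData M) (T : SkewMonoidaleData N)
    (C : OpmonoidalData S.toProductUnit T.toProductUnit) : Prop :=
  S.leftCell ▷ C.C ⊗≫
      (S.u ⊠₁ 𝟙 M) ◁ C.C2 ⊗≫
      ((preLeft S.u C.C C.C).hom ≫ (C.C0 ⊠₂ 𝟙 C.C) ≫ (tensorRL T.u C.C).inv) ▷ T.m =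
    (leftUnitNat C.C).inv ⊗≫ (𝟙 tensorUnit ⊠₁ C.C) ◁ T.leftCell ⊗≫
      𝟙 (((𝟙 tensorUnit ⊠₁ C.C) ≫ (T.u ⊠₁ 𝟙 N)) ≫ T.m)

/-- An opmonoidal arrow.  The first two laws are the coassociative and counit laws for `C` as a
comodule over itself between the regular actions. -/
structure OpmonoidalArrow {M N : 𝓜} (S : SkewMonoidaleData M) (T : SkewMonoidaleData N) extends
    OpmonoidalData S.toProductUnit T.toProductUnit where
  coassoc : Coassociative S.regular T.regular toOpmonoidalData C C2
  right_counit : Counital S.regular T.regular toOpmonoidalData C C2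
  left_counit : LeftCounital S T toOpmonoidalData

namespace OpmonoidalData

variable {M N L : 𝓜} {p : ProductUnit M} {q : ProductUnit N} {r : ProductUnit L}

variable (p) in
/-- The identity opmonoidal arrow. -/
def id : OpmonoidalData p p where
  C := 𝟙 M
  C2 := (ρ_ p.m).hom ≫ (λ_ p.m).inv ≫ (tensorId M M).inv ▷ p.m
  C0 := (ρ_ p.u).hom

/-- The composite of opmonoidal arrows. -/
def comp (C : OpmonoidalData p q) (D : OpmonoidalData q r) : OpmonoidalData p r where
  C := C.C ≫ D.C
  C2 := 𝟙 (p.m ≫ C.C ≫ D.C) ⊗≫ C.C2 ▷ D.C ⊗≫ (C.C ⊠₁ C.C) ◁ D.C2 ⊗≫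
    (tensorComp C.C D.C C.C D.C).inv ▷ r.m
  C0 := 𝟙 (p.u ≫ C.C ≫ D.C) ⊗≫ C.C0 ▷ D.C ⊗≫ D.C0

/-- The two conditions for a cell between opmonoidal arrows to be opmonoidal. -/
structure IsOpmonoidalCell (C C' : OpmonoidalData p q) (ξ : C.C ⟶ C'.C) : Prop where
  mul : p.m ◁ ξ ≫ C'.C2 = C.C2 ≫ (ξ ⊠₂ ξ) ▷ q.m
  unit : p.u ◁ ξ ≫ C'.C0 = C.C0

end OpmonoidalData

/-- An opmonoidal monad on a skew monoidale: a monad whose underlying arrow is opmonoidal and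
whose multiplication and unit are opmonoidal cells, i.e. a monad in the bicategory of skew
monoidales, opmonoidal arrows and opmonoidal cells. -/
structure OpmonoidalMonad {M : 𝓜} (S : SkewMonoidaleData M) extends OpmonoidalArrow S S where
  μ : C ≫ C ⟶ C
  η : 𝟙 M ⟶ C
  μ_opmonoidal :
    OpmonoidalData.IsOpmonoidalCell (toOpmonoidalData.comp toOpmonoidalData) toOpmonoidalData μ
  η_opmonoidal :
    OpmonoidalData.IsOpmonoidalCell (OpmonoidalData.id S.toProductUnit) toOpmonoidalData η
  μ_assoc : μ ▷ C ≫ μ = (α_ C C C).hom ≫ C ◁ μ ≫ μ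
  η_μ : η ▷ C ≫ μ = (λ_ C).hom
  μ_η : C ◁ η ≫ μ = (ρ_ C).hom

section Comodules

variable {M N : 𝓜} {p : ProductUnit M} {q : ProductUnit N} {A B : 𝓜}

/-- An arrow with a coaction cell (no laws imposed). -/
structure ComoduleData (a : ActionData p A) (b : ActionData q B) (C : OpmonoidalData p q) where
  Y : A ⟶ B
  y : a.a ≫ Y ⟶ (Y ⊠₁ C.C) ≫ b.a

/-- Right `C`-comodules from `a` to `b`. -/
structure RightComodule (a : ActionData p A) (b : ActionData q B) (C : OpmonoidalData p q) extends
    ComoduleData a b C where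
  coassoc : Coassociative a b C Y y
  counit : Counital a b C Y y

namespace RightComodule

variable {a : ActionData p A} {b : ActionData q B} {C : OpmonoidalData p q}

/-- Morphisms of right `C`-comodules (over the identity cell of `C`). -/
@[ext]
structure Hom (Y Y' : RightComodule a b C) where
  γ : Y.Y ⟶ Y'.Y
  comm : a.a ◁ γ ≫ Y'.y = Y.y ≫ (γ ⊠₂ 𝟙 C.C) ▷ b.a

instance : Category (RightComodule a b C) where
  Hom := Hom
  id Y :=
    { γ := 𝟙 Y.Y
      comm := by
        rw [tensorCell_id, Bicategory.whiskerLeft_id, Bicategory.id_whiskerRight,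
          Category.id_comp, Category.comp_id] }
  comp f g :=
    { γ := f.γ ≫ g.γ
      comm := by
        rw [← Category.comp_id (𝟙 C.C), tensorCell_comp, Bicategory.whiskerLeft_comp,
          Bicategory.comp_whiskerRight, Category.assoc, g.comm, ← Category.assoc, f.comm,
          Category.assoc] }
  id_comp f := Hom.ext (Category.id_comp f.γ)
  comp_id f := Hom.ext (Category.comp_id f.γ)
  assoc f g h := Hom.ext (Category.assoc f.γ g.γ h.γ)

/-- The forgetful functor from right `C`-comodules from `a` to `b` to the category of arrows. -/
def forget (a : ActionData p A) (b : ActionData q B) (C : OpmonoidalData p q) :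
    RightComodule a b C ⥤ (A ⟶ B) where
  obj Y := Y.Y
  map f := Hom.γ f

end RightComodule

/-- The tensor product of two arrows with coactions over a monad with multiplication `μ`: their
horizontal composite (first `Y`, then `Z`), with the pasted coaction followed by `μ`. -/
def ComoduleData.tensor {a : ActionData p A} {C : OpmonoidalData p p} (μ : C.C ≫ C.C ⟶ C.C)
    (Y Z : ComoduleData a a C) : ComoduleData a a C where
  Y := Y.Y ≫ Z.Y
  y := 𝟙 (a.a ≫ Y.Y ≫ Z.Y) ⊗≫ Y.y ▷ Z.Y ⊗≫ (Y.Y ⊠₁ C.C) ◁ Z.y ⊗≫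
    ((tensorComp Y.Y Z.Y C.C C.C).inv ≫ (𝟙 (Y.Y ≫ Z.Y) ⊠₂ μ)) ▷ a.a

/-- The unit: the identity arrow with the coaction induced by `η`. -/
def ComoduleData.unit (a : ActionData p A) {C : OpmonoidalData p p} (η : 𝟙 M ⟶ C.C) :
    ComoduleData a a C where
  Y := 𝟙 A
  y := (ρ_ a.a).hom ≫ (λ_ a.a).inv ≫ ((tensorId A M).inv ≫ (𝟙 (𝟙 A) ⊠₂ η)) ▷ a.a

end Comodules

/-- The category of right `B`-comodules from `a` to `a` is monoidal, with tensor product and unit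
given on objects by `ComoduleData.tensor` and `ComoduleData.unit`, and the forgetful functor to
the category of endo-arrows of `A`, monoidal under composition, is strong monoidal with
constraints given by identities. -/
def HasComodMonoidalStructure {M : 𝓜} {S : SkewMonoidaleData M} {A : 𝓜}
    (a : ActionData S.toProductUnit A) (B : OpmonoidalMonad S) : Prop :=
  ∃ (_ : MonoidalCategory (RightComodule a a B.toOpmonoidalData))
    (tensor_eq : ∀ Y Z : RightComodule a a B.toOpmonoidalData,
      (MonoidalCategory.tensorObj Y Z).toComoduleData =
        ComoduleData.tensor B.μ Y.toComoduleData Z.toComoduleData)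
    (unit_eq : (MonoidalCategory.tensorUnit
        (RightComodule a a B.toOpmonoidalData)).toComoduleData = ComoduleData.unit a B.η)
    (F : (RightComodule.forget a a B.toOpmonoidalData).Monoidal),
    (∀ Y Z : RightComodule a a B.toOpmonoidalData,
      F.μ Y Z = eqToHom (congrArg ComoduleData.Y (tensor_eq Y Z)).symm) ∧
    F.ε = eqToHom (congrArg ComoduleData.Y unit_eq).symm

/-! ### Bidualities and enveloping monoidales -/

/-- The data of a right bidual `P` of `R`: a unit `n`, a counit `e` and the two triangle
isomorphisms. -/
structure BidualityData (R P : 𝓜) where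
  n : tensorUnit ⟶ P ⊠ R
  e : R ⊠ P ⟶ tensorUnit
  leftTriangle : lu P ≅ (n ⊠₁ 𝟙 P) ≫ as P R P ≫ (𝟙 P ⊠₁ e) ≫ ru P
  rightTriangle : (𝟙 R ⊠₁ n) ≫ asInv R P R ≫ (e ⊠₁ 𝟙 R) ≫ lu R ≅ ru R

namespace BidualityData

variable {R P : 𝓜} (D : BidualityData R P)

/-- The evaluation arrow `e1 : R(PX) ⟶ X`. -/
def ev (X : 𝓜) : R ⊠ (P ⊠ X) ⟶ X := asInv R P X ≫ (D.e ⊠₁ 𝟙 X) ≫ lu X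

/-- Naturality of evaluation (an interchange isomorphism). -/
def evNat {X Y : 𝓜} (f : X ⟶ Y) : (𝟙 R ⊠₁ (𝟙 P ⊠₁ f)) ≫ D.ev Y ≅ D.ev X ≫ f :=
  (α_ _ _ _).symm ≪≫
    whiskerRightIso (invSquare (assocEquiv R P X) (assocEquiv R P Y) (assocNatRight R P f))
      ((D.e ⊠₁ 𝟙 Y) ≫ lu Y) ≪⊗≫
    whiskerLeftIso (asInv R P X) (whiskerRightIso (exch D.e f).symm (lu Y)) ≪⊗≫
    whiskerLeftIso (asInv R P X ≫ (D.e ⊠₁ 𝟙 X)) (leftUnitNat f) ≪⊗≫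
    Iso.refl ((asInv R P X ≫ (D.e ⊠₁ 𝟙 X) ≫ lu X) ≫ f)

/-- Evaluation at a tensor product (a coherence isomorphism). -/
def evAssoc (X Y : 𝓜) :
    as R (P ⊠ X) Y ≫ (𝟙 R ⊠₁ as P X Y) ≫ D.ev (X ⊠ Y) ≅ D.ev X ⊠₁ 𝟙 Y :=
  Iso.refl (as R (P ⊠ X) Y ≫ (𝟙 R ⊠₁ as P X Y) ≫ asInv R P (X ⊠ Y) ≫
      (D.e ⊠₁ 𝟙 (X ⊠ Y)) ≫ lu (X ⊠ Y)) ≪⊗≫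
    whiskerRightIso (pentagonInvLeft R P X Y) ((D.e ⊠₁ 𝟙 (X ⊠ Y)) ≫ lu (X ⊠ Y)) ≪⊗≫
    whiskerLeftIso (asInv R P X ⊠₁ 𝟙 Y)
      (whiskerRightIso (assocNatLeft D.e X Y).symm (lu (X ⊠ Y))) ≪⊗≫
    whiskerLeftIso ((asInv R P X ⊠₁ 𝟙 Y) ≫ ((D.e ⊠₁ 𝟙 X) ⊠₁ 𝟙 Y))
      (leftUnitMod X Y).symm ≪⊗≫
    tripleRight (asInv R P X) (D.e ⊠₁ 𝟙 X) (lu X) Y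

/-- Evaluation at the unit object. -/
def evUnit : D.ev tensorUnit ≅ (𝟙 R ⊠₁ ru P) ≫ D.e :=
  whiskerLeftIso (asInv R P tensorUnit) (whiskerLeftIso (D.e ⊠₁ 𝟙 tensorUnit) unitIso) ≪≫
    whiskerLeftIso (asInv R P tensorUnit) (rightUnitNat D.e) ≪≫
    whiskerLeftIso (asInv R P tensorUnit) (whiskerRightIso (rightUnitMod R P) D.e) ≪⊗≫
    whiskerRightIso (assocEquiv R P tensorUnit).counit ((𝟙 R ⊠₁ ru P) ≫ D.e) ≪≫
    λ_ ((𝟙 R ⊠₁ ru P) ≫ D.e)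

/-- The product `1e1` and unit `n` of the enveloping monoidale. -/
abbrev productUnit : ProductUnit (P ⊠ R) where
  m := as P R (P ⊠ R) ≫ (𝟙 P ⊠₁ D.ev R)
  u := D.n

/-- The action of the enveloping monoidale on `R` given by `e1`; the associator cell is an
interchange isomorphism and the right unitor cell is the right triangle isomorphism. -/
def evaluation : ActionData D.productUnit R where
  a := D.ev R
  a2 := (Iso.refl (as R (P ⊠ R) (P ⊠ R) ≫
        (𝟙 R ⊠₁ (as P R (P ⊠ R) ≫ (𝟙 P ⊠₁ D.ev R))) ≫ D.ev R) ≪⊗≫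
      whiskerLeftIso (as R (P ⊠ R) (P ⊠ R))
        (whiskerRightIso (preRight (𝟙 R) (as P R (P ⊠ R)) (𝟙 P ⊠₁ D.ev R)).symm
          (D.ev R)) ≪⊗≫
      whiskerLeftIso (as R (P ⊠ R) (P ⊠ R) ≫ (𝟙 R ⊠₁ as P R (P ⊠ R)))
        (D.evNat (D.ev R)) ≪⊗≫
      whiskerRightIso (D.evAssoc R (P ⊠ R)) (D.ev R)).hom
  a0 := D.rightTriangle.hom

/-- The left unitor isomorphism `ς_l 1`, at a general object `X`. -/
def leftUnitorIso (X : 𝓜) :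
    lu (P ⊠ X) ≅ (D.n ⊠₁ 𝟙 (P ⊠ X)) ≫ as P R (P ⊠ X) ≫ (𝟙 P ⊠₁ D.ev X) :=
  (λ_ _).symm ≪≫
    whiskerRightIso (assocEquiv tensorUnit P X).counit.symm (lu (P ⊠ X)) ≪⊗≫
    whiskerLeftIso (asInv tensorUnit P X)
      ((leftUnitMod P X).symm ≪≫ tensorIso D.leftTriangle (Iso.refl (𝟙 X)) ≪≫
        (preLeft (D.n ⊠₁ 𝟙 P) (as P R P ≫ (𝟙 P ⊠₁ D.e) ≫ ru P) (𝟙 X)).symm ≪≫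
        whiskerLeftIso _ (tripleRight (as P R P) (𝟙 P ⊠₁ D.e) (ru P) X).symm) ≪⊗≫
    whiskerLeftIso (asInv tensorUnit P X ≫ ((D.n ⊠₁ 𝟙 P) ⊠₁ 𝟙 X) ≫ (as P R P ⊠₁ 𝟙 X) ≫
        ((𝟙 P ⊠₁ D.e) ⊠₁ 𝟙 X)) (midUnitMod P X) ≪⊗≫
    whiskerLeftIso (asInv tensorUnit P X ≫ ((D.n ⊠₁ 𝟙 P) ⊠₁ 𝟙 X) ≫ (as P R P ⊠₁ 𝟙 X))
      (whiskerRightIso (assocNatMid P D.e X) (𝟙 P ⊠₁ lu X)) ≪⊗≫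
    whiskerRightIso (invSquare (assocEquiv tensorUnit P X) (assocEquiv (P ⊠ R) P X)
        (assocNatLeft D.n P X)).symm
      ((as P R P ⊠₁ 𝟙 X) ≫ as P (R ⊠ P) X ≫ (𝟙 P ⊠₁ (D.e ⊠₁ 𝟙 X)) ≫ (𝟙 P ⊠₁ lu X)) ≪⊗≫
    whiskerLeftIso (D.n ⊠₁ 𝟙 (P ⊠ X)) (whiskerRightIso (pentagonInvRight P R P X)
      ((𝟙 P ⊠₁ (D.e ⊠₁ 𝟙 X)) ≫ (𝟙 P ⊠₁ lu X))) ≪⊗≫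
    whiskerLeftIso ((D.n ⊠₁ 𝟙 (P ⊠ X)) ≫ as P R (P ⊠ X))
      (tripleLeft P (asInv R P X) (D.e ⊠₁ 𝟙 X) (lu X)) ≪⊗≫
    Iso.refl ((D.n ⊠₁ 𝟙 (P ⊠ X)) ≫ as P R (P ⊠ X) ≫
      (𝟙 P ⊠₁ (asInv R P X ≫ (D.e ⊠₁ 𝟙 X) ≫ lu X)))

end BidualityData

/-- Tensoring an action on `A` with an object `P` on the left gives an action on `PA`. -/
def ActionData.tensorLeft {M : 𝓜} {p : ProductUnit M} (P : 𝓜) {A : 𝓜} (a : ActionData p A) :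
    ActionData p (P ⊠ A) where
  a := as P A M ≫ (𝟙 P ⊠₁ a.a)
  a2 := 𝟙 (as (P ⊠ A) M M ≫ (𝟙 (P ⊠ A) ⊠₁ p.m) ≫ as P A M ≫ (𝟙 P ⊠₁ a.a)) ⊗≫
    as (P ⊠ A) M M ◁ (assocNatRight P A p.m).hom ▷ (𝟙 P ⊠₁ a.a) ⊗≫
    (pentagonator P A M M).inv ▷ ((𝟙 P ⊠₁ (𝟙 A ⊠₁ p.m)) ≫ (𝟙 P ⊠₁ a.a)) ⊗≫
    ((as P A M ⊠₁ 𝟙 M) ≫ as P (A ⊠ M) M) ◁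
      ((tripleLeft P _ _ _).hom ≫ (𝟙 (𝟙 P) ⊠₂ a.a2) ≫ (preRight (𝟙 P) _ _).inv) ⊗≫
    (as P A M ⊠₁ 𝟙 M) ◁ (assocNatMid P a.a M).inv ▷ (𝟙 P ⊠₁ a.a) ⊗≫
    (preLeft (as P A M) (𝟙 P ⊠₁ a.a) (𝟙 M)).hom ▷ (as P A M ≫ (𝟙 P ⊠₁ a.a))
  a0 := 𝟙 ((𝟙 (P ⊠ A) ⊠₁ p.u) ≫ as P A M ≫ (𝟙 P ⊠₁ a.a)) ⊗≫
    (assocNatRight P A p.u).hom ▷ (𝟙 P ⊠₁ a.a) ⊗≫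
    as P A tensorUnit ◁ ((preRight (𝟙 P) _ _).hom ≫ (𝟙 (𝟙 P) ⊠₂ a.a0)) ⊗≫
    (rightUnitMod P A).inv

/-- The enveloping monoidale `PR` of a biduality: the product is `1e1`, the unit is `n`, the
associator is the interchange isomorphism and the unitors are `ς_l 1` and `1 ς_r`. -/
def BidualityData.enveloping {R P : 𝓜} (D : BidualityData R P) : SkewMonoidaleData (P ⊠ R) where
  toProductUnit := D.productUnit
  assocCell := (D.evaluation.tensorLeft P).a2
  leftCell := (D.leftUnitorIso R).hom
  rightCell := (D.evaluation.tensorLeft P).a0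

/-- A biduality `R ⊣ P`: the two swallowtail equations hold.  The second one says that the
pasting `n ⟶ n` of the two triangle isomorphisms with interchange is the identity. -/
structure Biduality (R P : 𝓜) extends BidualityData R P where
  swallowtail_counit :
    𝟙 (((𝟙 R ⊠₁ n) ⊠₁ 𝟙 P) ≫ (toBidualityData.ev R ⊠₁ 𝟙 P) ≫ e) ⊗≫
        ((preLeft (𝟙 R ⊠₁ n) (toBidualityData.ev R) (𝟙 P)).hom ≫
          (rightTriangle.hom ⊠₂ 𝟙 (𝟙 P))) ▷ e =
      𝟙 (((𝟙 R ⊠₁ n) ⊠₁ 𝟙 P) ≫ (toBidualityData.ev R ⊠₁ 𝟙 P) ≫ e) ⊗≫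
        ((𝟙 R ⊠₁ n) ⊠₁ 𝟙 P) ◁ (toBidualityData.evAssoc R P).inv ▷ e ⊗≫
        (((𝟙 R ⊠₁ n) ⊠₁ 𝟙 P) ≫ as R (P ⊠ R) P ≫ (𝟙 R ⊠₁ as P R P)) ◁
          (toBidualityData.evNat e).inv ⊗≫
        (((𝟙 R ⊠₁ n) ⊠₁ 𝟙 P) ≫ as R (P ⊠ R) P ≫ (𝟙 R ⊠₁ as P R P) ≫
          (𝟙 R ⊠₁ (𝟙 P ⊠₁ e))) ◁ toBidualityData.evUnit.hom ⊗≫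
        (assocNatMid R n P).hom ▷
          ((𝟙 R ⊠₁ as P R P) ≫ (𝟙 R ⊠₁ (𝟙 P ⊠₁ e)) ≫ (𝟙 R ⊠₁ ru P) ≫ e) ⊗≫
        as R tensorUnit P ◁ ((𝟙 R ⊠₁ (n ⊠₁ 𝟙 P)) ◁ (tripleLeft R _ _ _).hom ≫
          (preRight (𝟙 R) _ _).hom ≫ (𝟙 (𝟙 R) ⊠₂ leftTriangle.inv)) ▷ e ⊗≫
        (midUnitMod R P).inv ▷ e
  swallowtail_unit : UnitUnitLaw toBidualityData.enveloping

end MonoidalBicategory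

open MonoidalBicategory

/-! ### Squares in a bicategory -/

/-! A coaction `y : a ≫ Y ⟶ (Y ⊠₁ C) ≫ b` is a square: its left and right edges are the actions `a`
and `b`, its bottom edge is `Y` and its top edge is `Y ⊠₁ C`. Two such squares paste side by side
along a common action, giving the top edge `(Y ⊠₁ C) ≫ (Z ⊠₁ C)`, which the interchange constraint
and `μ` turn into `(Y ≫ Z) ⊠₁ C`. This is the tensor product of comodules; the unit is its nullary
case, with `η` in place of `μ`.

In these terms the comodule laws are equations between vertical pastings (`coassociative_iff`,
`counital_iff`). For a composite coaction, each such pasting becomes a horizontal pasting of one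
column for `Y` and one for `Z`. This rests on the interchange law for pastings (`hcomp_vcomp`), on
the tensor product of squares respecting horizontal pasting (`tsq_hcomp`), on pseudonaturality of
the associativity and right unit arrows (`assocNat_inv_comp`, `rightUnitNat_comp'`), and on the
compatibility of `μ` with `C2` and `C0`. The law for `Y` then carries the structure cell of the
action from the left edge to the middle one, and the law for `Z` carries it on to the right edge.

A comodule morphism is a cell of `𝓜(A, A)` with a property. The associators and unitors of
composition have this property because `C` is a monad. The forgetful functor is faithful, so the
monoidal axioms follow from those of `𝓜(A, A)`. The argument applies to any action data, and the
theorem and the corollary are two instances of it. -/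

namespace BicategorySquare

section

variable {𝓑 : Type u} [Bicategory.{w, v} 𝓑]

/-- Pasting of two squares side by side. -/
def hcomp {X X' Y Y' Z Z' : 𝓑} {a : X ⟶ X'} {b : Y ⟶ Y'} {c : Z ⟶ Z'} {F : X ⟶ Y} {G : X' ⟶ Y'}
    {F' : Y ⟶ Z} {G' : Y' ⟶ Z'} (s : a ≫ G ⟶ F ≫ b) (t : b ≫ G' ⟶ F' ≫ c) :
    a ≫ G ≫ G' ⟶ (F ≫ F') ≫ c :=
  (α_ a G G').inv ≫ s ▷ G' ≫ (α_ F b G').hom ≫ F ◁ t ≫ (α_ F F' c).inv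

/-- Pasting of two squares on top of each other. -/
def vcomp {X X' X'' Y Y' Y'' : 𝓑} {a : X ⟶ X'} {a' : X' ⟶ X''} {b : Y ⟶ Y'} {b' : Y' ⟶ Y''}
    {F : X ⟶ Y} {G : X' ⟶ Y'} {H : X'' ⟶ Y''} (s : a ≫ G ⟶ F ≫ b) (t : a' ≫ H ⟶ G ≫ b') :
    (a ≫ a') ≫ H ⟶ F ≫ b ≫ b' :=
  (α_ a a' H).hom ≫ a ◁ t ≫ (α_ a G b').inv ≫ s ▷ b' ≫ (α_ F b b').hom

/-- The identity square on an arrow, between identity arrows. -/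
def idArrow {X Y : 𝓑} (F : X ⟶ Y) : 𝟙 X ≫ F ⟶ F ≫ 𝟙 Y := (λ_ F).hom ≫ (ρ_ F).inv

/-- The identity square on an arrow, between identity arrows in the other direction. -/
def arrowId {X Y : 𝓑} (a : X ⟶ Y) : a ≫ 𝟙 Y ⟶ 𝟙 X ≫ a := (ρ_ a).hom ≫ (λ_ a).inv

section hcomp

variable {X X' Y Y' Z Z' : 𝓑} {a : X ⟶ X'} {b : Y ⟶ Y'} {c : Z ⟶ Z'} {F F₁ : X ⟶ Y}
  {G G₁ : X' ⟶ Y'} {F' F₁' : Y ⟶ Z} {G' G₁' : Y' ⟶ Z'}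

/-- A cell on any outer edge of a horizontal pasting can be pulled out, and one on the shared edge
can be given to either square. These moves replace diagram chasing in all later proofs. -/
lemma hcomp_comp_right (s : a ≫ G ⟶ F ≫ b) (t : b ≫ G' ⟶ F' ≫ c) (φ : F' ⟶ F₁') :
    hcomp s (t ≫ φ ▷ c) = hcomp s t ≫ (F ◁ φ) ▷ c := by
  simp [hcomp]

lemma hcomp_comp_left (s : a ≫ G ⟶ F ≫ b) (t : b ≫ G' ⟶ F' ≫ c) (φ : F ⟶ F₁) :
    hcomp (s ≫ φ ▷ b) t = hcomp s t ≫ (φ ▷ F') ▷ c := by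
  simp only [hcomp, comp_whiskerRight, Category.assoc, associator_inv_naturality_left,
    associator_naturality_left_assoc, ← whisker_exchange_assoc]

lemma comp_hcomp_right (s : a ≫ G ⟶ F ≫ b) (t : b ≫ G₁' ⟶ F' ≫ c) (γ : G' ⟶ G₁') :
    hcomp s (b ◁ γ ≫ t) = a ◁ G ◁ γ ≫ hcomp s t := by
  simp only [hcomp, whiskerLeft_comp, Category.assoc, associator_inv_naturality_right_assoc,
    ← whisker_exchange_assoc, ← associator_naturality_right_assoc]

lemma comp_hcomp_left (s : a ≫ G₁ ⟶ F ≫ b) (t : b ≫ G' ⟶ F' ≫ c) (γ : G ⟶ G₁) :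
    hcomp (a ◁ γ ≫ s) t = a ◁ γ ▷ G' ≫ hcomp s t := by
  simp [hcomp]

lemma hcomp_middle {b' : Y ⟶ Y'} (s : a ≫ G ⟶ F ≫ b) (t : b' ≫ G' ⟶ F' ≫ c) (β : b ⟶ b') :
    hcomp (s ≫ F ◁ β) t = hcomp s (β ▷ G' ≫ t) := by
  simp [hcomp]

lemma comp_hcomp {a' : X ⟶ X'} (s : a' ≫ G ⟶ F ≫ b) (t : b ≫ G' ⟶ F' ≫ c) (β : a ⟶ a') :
    hcomp (β ▷ G ≫ s) t = β ▷ (G ≫ G') ≫ hcomp s t := by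
  simp [hcomp]

lemma hcomp_comp {c' : Z ⟶ Z'} (s : a ≫ G ⟶ F ≫ b) (t : b ≫ G' ⟶ F' ≫ c) (β : c ⟶ c') :
    hcomp s (t ≫ F' ◁ β) = hcomp s t ≫ (F ≫ F') ◁ β := by
  simp [hcomp]

lemma hcomp_assoc {W W' : 𝓑} {d : W ⟶ W'} {F'' : Z ⟶ W} {G'' : Z' ⟶ W'}
    (s : a ≫ G ⟶ F ≫ b) (t : b ≫ G' ⟶ F' ≫ c) (r : c ≫ G'' ⟶ F'' ≫ d) :
    hcomp (hcomp s t) r ≫ (α_ F F' F'').hom ▷ d = a ◁ (α_ G G' G'').hom ≫ hcomp s (hcomp t r) := by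
  simp only [hcomp]
  bicategory

lemma hcomp_arrowId_left (t : b ≫ G' ⟶ F' ≫ c) :
    hcomp (arrowId b) t ≫ (λ_ F').hom ▷ c = b ◁ (λ_ G').hom ≫ t := by
  simp only [hcomp, arrowId]
  bicategory

lemma hcomp_arrowId_right (s : a ≫ G ⟶ F ≫ b) :
    hcomp s (arrowId b) ≫ (ρ_ F).hom ▷ b = a ◁ (ρ_ G).hom ≫ s := by
  simp only [hcomp, arrowId]
  bicategory

lemma idArrow_naturality (γ : F ⟶ F₁) : 𝟙 X ◁ γ ≫ idArrow F₁ = idArrow F ≫ γ ▷ 𝟙 Y := by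
  simp [idArrow]

lemma arrowId_naturality {a' : X ⟶ X'} (β : a ⟶ a') :
    β ▷ 𝟙 X' ≫ arrowId a' = arrowId a ≫ 𝟙 X ◁ β := by
  simp [arrowId]

/-- By `λ_ (𝟙 X) = ρ_ (𝟙 X)`. In the unit comodule the horizontal edge is itself an identity, so its
square can also be read as an identity in the other direction. -/
lemma idArrow_id (X : 𝓑) : idArrow (𝟙 X) = arrowId (𝟙 X) := by
  simp [idArrow, arrowId, unitors_equal, unitors_inv_equal]

/-- Splits the identity square on `Y ≫ Z` or on `C ≫ C` into one piece for each of two composed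
comodules. -/
lemma hcomp_idArrow {Z : 𝓑} (F : X ⟶ Y) (F' : Y ⟶ Z) :
    hcomp (idArrow F) (idArrow F') = idArrow (F ≫ F') := by
  simp only [hcomp, idArrow]
  bicategory

end hcomp

section vcomp

variable {X X' X'' Y Y' Y'' : 𝓑} {a : X ⟶ X'} {a' : X' ⟶ X''} {b : Y ⟶ Y'} {b' : Y' ⟶ Y''}
    {F F₁ : X ⟶ Y} {G G₁ : X' ⟶ Y'} {H H₁ : X'' ⟶ Y''}

lemma vcomp_middle (s : a ≫ G₁ ⟶ F ≫ b) (t : a' ≫ H ⟶ G ≫ b') (γ : G ⟶ G₁) :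
    vcomp s (t ≫ γ ▷ b') = vcomp (a ◁ γ ≫ s) t := by
  simp [vcomp]

lemma vcomp_comp (s : a ≫ G ⟶ F ≫ b) (t : a' ≫ H ⟶ G ≫ b') (φ : F ⟶ F₁) :
    vcomp (s ≫ φ ▷ b) t = vcomp s t ≫ φ ▷ (b ≫ b') := by
  simp [vcomp]

lemma vcomp_arrowId (a : X ⟶ X') (a' : X' ⟶ X'') :
    vcomp (arrowId a) (arrowId a') = arrowId (a ≫ a') := by
  simp only [vcomp, arrowId]
  bicategory

/-- Both pastings start with the lower left square `t` and end with the upper right square `s'`.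
They differ only in the order of `s` and `t'`, which do not overlap, so `whisker_exchange` suffices.
-/
lemma hcomp_vcomp {Z Z' Z'' : 𝓑} {c : Z ⟶ Z'} {c' : Z' ⟶ Z''} {F' : Y ⟶ Z} {G' : Y' ⟶ Z'}
    {H' : Y'' ⟶ Z''} (s : a ≫ G ⟶ F ≫ b) (t : a' ≫ H ⟶ G ≫ b') (s' : b ≫ G' ⟶ F' ≫ c)
    (t' : b' ≫ H' ⟶ G' ≫ c') :
    hcomp (vcomp s t) (vcomp s' t') = vcomp (hcomp s s') (hcomp t t') := by
  trans 𝟙 _ ⊗≫ a ◁ t ▷ H' ⊗≫ (s ▷ (b' ≫ H') ≫ (F ≫ b) ◁ t') ⊗≫ F ◁ s' ▷ c' ⊗≫ 𝟙 _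
  · simp only [hcomp, vcomp]
    bicategory
  · rw [← whisker_exchange]
    simp only [hcomp, vcomp]
    bicategory

end vcomp

end

/-! ### Tensor products of squares -/

section

variable {𝓜 : Type u} [Bicategory.{w, v} 𝓜] [TensorBicategory 𝓜]

lemma tensorCell_comp_assoc {X Y X' Y' : 𝓜} {f g h : X ⟶ Y} {f' g' h' : X' ⟶ Y'}
    (η : f ⟶ g) (θ : g ⟶ h) (η' : f' ⟶ g') (θ' : g' ⟶ h') {k : X ⊠ X' ⟶ Y ⊠ Y'}
    (κ : h ⊠₁ h' ⟶ k) :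
    ((η ≫ θ) ⊠₂ (η' ≫ θ')) ≫ κ = (η ⊠₂ η') ≫ (θ ⊠₂ θ') ≫ κ := by
  rw [tensorCell_comp, Category.assoc]

-- Oriented so that `simp` moves whiskerings out of tensor products, at the price of interchange
-- constraints that later cancel.
@[simp]
lemma tensorComp_whiskerLeft' {X Y Z X' Y' Z' : 𝓜} (f : X ⟶ Y) {g h : Y ⟶ Z} (η : g ⟶ h)
    (f' : X' ⟶ Y') {g' h' : Y' ⟶ Z'} (η' : g' ⟶ h') :
    (f ◁ η) ⊠₂ (f' ◁ η') = (tensorComp f g f' g').hom ≫ (f ⊠₁ f') ◁ (η ⊠₂ η') ≫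
      (tensorComp f h f' h').inv := by
  rw [← Category.assoc, ← tensorComp_whiskerLeft, Category.assoc, Iso.hom_inv_id, Category.comp_id]

@[simp]
lemma tensorComp_whiskerRight' {X Y Z X' Y' Z' : 𝓜} {f g : X ⟶ Y} (η : f ⟶ g) (h : Y ⟶ Z)
    {f' g' : X' ⟶ Y'} (η' : f' ⟶ g') (h' : Y' ⟶ Z') :
    (η ▷ h) ⊠₂ (η' ▷ h') = (tensorComp f h f' h').hom ≫ (η ⊠₂ η') ▷ (h ⊠₁ h') ≫
      (tensorComp g h g' h').inv := by
  rw [← Category.assoc, ← tensorComp_whiskerRight, Category.assoc, Iso.hom_inv_id, Category.comp_id]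

variable {X X' Y Y' Z Z' P P' Q Q' R R' : 𝓜} {a : X ⟶ X'} {b : Y ⟶ Y'} {c : Z ⟶ Z'}
  {F F₁ : X ⟶ Y} {G G₁ : X' ⟶ Y'} {F' F₁' : Y ⟶ Z} {G' G₁' : Y' ⟶ Z'} {p : P ⟶ P'} {q : Q ⟶ Q'}
  {r : R ⟶ R'} {H H₁ : P ⟶ Q} {K K₁ : P' ⟶ Q'} {H' H₁' : Q ⟶ R} {K' K₁' : Q' ⟶ R'}

/-- The tensor product of two squares. -/
def tsq (s : a ≫ G ⟶ F ≫ b) (t : p ≫ K ⟶ H ≫ q) :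
    (a ⊠₁ p) ≫ (G ⊠₁ K) ⟶ (F ⊠₁ H) ≫ (b ⊠₁ q) :=
  (tensorComp a G p K).inv ≫ (s ⊠₂ t) ≫ (tensorComp F b H q).hom

lemma tsq_comp (s : a ≫ G ⟶ F ≫ b) (t : p ≫ K ⟶ H ≫ q) (φ : F ⟶ F₁) (ψ : H ⟶ H₁) :
    tsq (s ≫ φ ▷ b) (t ≫ ψ ▷ q) = tsq s t ≫ (φ ⊠₂ ψ) ▷ (b ⊠₁ q) := by
  simp [tsq, tensorCell_comp]

lemma comp_tsq (s : a ≫ G₁ ⟶ F ≫ b) (t : p ≫ K₁ ⟶ H ≫ q) (φ : G ⟶ G₁) (ψ : K ⟶ K₁) :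
    tsq (a ◁ φ ≫ s) (p ◁ ψ ≫ t) = (a ⊠₁ p) ◁ (φ ⊠₂ ψ) ≫ tsq s t := by
  simp [tsq, tensorCell_comp]

lemma tensorCell_associator_hom (f : X ⟶ Y) (g : Y ⟶ Z) (h : Z ⟶ Z') (f' : P ⟶ Q) (g' : Q ⟶ R)
    (h' : R ⟶ R') :
    (α_ f g h).hom ⊠₂ (α_ f' g' h').hom = (tensorComp (f ≫ g) h (f' ≫ g') h').hom ≫
      (tensorComp f g f' g').hom ▷ (h ⊠₁ h') ≫ (α_ (f ⊠₁ f') (g ⊠₁ g') (h ⊠₁ h')).hom ≫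
      (f ⊠₁ f') ◁ (tensorComp g h g' h').inv ≫ (tensorComp f (g ≫ h) f' (g' ≫ h')).inv := by
  have := tensorComp_assoc f g h f' g' h'
  rw [← reassoc_of% this]
  simp

lemma tensorCell_associator_inv (f : X ⟶ Y) (g : Y ⟶ Z) (h : Z ⟶ Z') (f' : P ⟶ Q) (g' : Q ⟶ R)
    (h' : R ⟶ R') :
    (α_ f g h).inv ⊠₂ (α_ f' g' h').inv = (tensorComp f (g ≫ h) f' (g' ≫ h')).hom ≫
      (f ⊠₁ f') ◁ (tensorComp g h g' h').hom ≫ (α_ (f ⊠₁ f') (g ⊠₁ g') (h ⊠₁ h')).inv ≫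
      (tensorComp f g f' g').inv ▷ (h ⊠₁ h') ≫ (tensorComp (f ≫ g) h (f' ≫ g') h').inv := by
  -- Seen as the inverse of an invertible cell, the left side is determined by the formula for the
  -- associators themselves.
  change (tensorIso (α_ f g h) (α_ f' g' h')).inv = _
  rw [← cancel_epi (tensorIso (α_ f g h) (α_ f' g' h')).hom, Iso.hom_inv_id]
  simp [tensorIso, tensorCell_associator_hom]

/-- Functoriality of the tensor product in the horizontal direction: naturality of the interchange
constraint and its compatibility with associators. -/
lemma tsq_hcomp (s : a ≫ G ⟶ F ≫ b) (s' : b ≫ G' ⟶ F' ≫ c) (t : p ≫ K ⟶ H ≫ q)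
    (t' : q ≫ K' ⟶ H' ≫ r) :
    tsq (hcomp s s') (hcomp t t') = (a ⊠₁ p) ◁ (tensorComp G G' K K').hom ≫
      hcomp (tsq s t) (tsq s' t') ≫ (tensorComp F F' H H').inv ▷ (c ⊠₁ r) := by
  simp [tsq, hcomp, tensorCell_comp, tensorCell_associator_hom, tensorCell_associator_inv]

lemma tensorCell_leftUnitor_inv (f : X ⟶ Y) (g : P ⟶ Q) :
    (λ_ f).inv ⊠₂ (λ_ g).inv = (λ_ (f ⊠₁ g)).inv ≫ (tensorId X P).inv ▷ (f ⊠₁ g) ≫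
      (tensorComp (𝟙 X) f (𝟙 P) g).inv := by
  change (tensorIso (λ_ f) (λ_ g)).inv = _
  rw [← cancel_epi (tensorIso (λ_ f) (λ_ g)).hom, Iso.hom_inv_id]
  simp [tensorIso, tensorComp_id_left]

/-- Nullary counterpart of `tsq_hcomp`, from the two unit axioms of the tensor pseudofunctor. -/
lemma tsq_arrowId (a : X ⟶ X') (p : P ⟶ P') :
    tsq (arrowId a) (arrowId p) = (a ⊠₁ p) ◁ (tensorId X' P').hom ≫ arrowId (a ⊠₁ p) ≫
      (tensorId X P).inv ▷ (a ⊠₁ p) := by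
  simp [tsq, arrowId, tensorCell_comp, tensorComp_id_right, tensorCell_leftUnitor_inv]

end

/-! ### Pseudonaturality of associativity and right unit, as pastings of squares -/

section

variable {𝓜 : Type u} [Bicategory.{w, v} 𝓜] [UnitalTensorBicategory 𝓜]

lemma assocNat_inv_cell {X Y Z X' Y' Z' : 𝓜} {f f' : X ⟶ X'} {g g' : Y ⟶ Y'} {h h' : Z ⟶ Z'}
    (η : f ⟶ f') (θ : g ⟶ g') (κ : h ⟶ h') :
    as X Y Z ◁ (η ⊠₂ (θ ⊠₂ κ)) ≫ (assocNat f' g' h').inv =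
      (assocNat f g h).inv ≫ ((η ⊠₂ θ) ⊠₂ κ) ▷ as X' Y' Z' := by
  rw [Iso.comp_inv_eq, Category.assoc, assocNat_cell, Iso.inv_hom_id_assoc]

/-- The inverse is used because it has the orientation `a ≫ G ⟶ F ≫ b` of a coaction;
pseudonaturality then becomes horizontal pasting. -/
lemma assocNat_inv_comp {X Y Z X' Y' Z' X'' Y'' Z'' : 𝓜} (f : X ⟶ X') (f' : X' ⟶ X'')
    (g : Y ⟶ Y') (g' : Y' ⟶ Y'') (h : Z ⟶ Z') (h' : Z' ⟶ Z'') :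
    (assocNat (f ≫ f') (g ≫ g') (h ≫ h')).inv =
      as X Y Z ◁ ((𝟙 (f ≫ f') ⊠₂ (tensorComp g g' h h').hom) ≫
        (tensorComp f f' (g ⊠₁ h) (g' ⊠₁ h')).hom) ≫
      hcomp (assocNat f g h).inv (assocNat f' g' h').inv ≫
      ((tensorComp (f ⊠₁ g) (f' ⊠₁ g') h h').inv ≫
        ((tensorComp f f' g g').inv ⊠₂ 𝟙 (h ≫ h'))) ▷ as X'' Y'' Z'' := by
  rw [← cancel_epi (assocNat (f ≫ f') (g ≫ g') (h ≫ h')).hom, Iso.hom_inv_id,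
    reassoc_of% assocNat_comp f f' g g' h h']
  simp [hcomp, ← comp_whiskerRight, ← comp_whiskerRight_assoc, ← tensorCell_comp, tensorCell_id]

lemma assocNat_inv_id (X Y Z : 𝓜) :
    (assocNat (𝟙 X) (𝟙 Y) (𝟙 Z)).inv =
      as X Y Z ◁ ((𝟙 (𝟙 X) ⊠₂ (tensorId Y Z).hom) ≫ (tensorId X (Y ⊠ Z)).hom) ≫
      arrowId (as X Y Z) ≫
      ((tensorId (X ⊠ Y) Z).inv ≫ ((tensorId X Y).inv ⊠₂ 𝟙 (𝟙 Z))) ▷ as X Y Z := by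
  rw [← cancel_epi (assocNat (𝟙 X) (𝟙 Y) (𝟙 Z)).hom, Iso.hom_inv_id,
    reassoc_of% assocNat_id X Y Z]
  simp [arrowId, ← comp_whiskerRight, ← tensorCell_comp, tensorCell_id]

lemma rightUnitNat_comp' {X Y Z : 𝓜} (f : X ⟶ Y) (g : Y ⟶ Z) :
    (preLeft f g (𝟙 tensorUnit)).hom ▷ ru Z ≫ (rightUnitNat (f ≫ g)).hom =
      (α_ _ _ _).hom ≫ (f ⊠₁ 𝟙 tensorUnit) ◁ (rightUnitNat g).hom ≫ (α_ _ _ _).inv ≫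
        (rightUnitNat f).hom ▷ g ≫ (α_ _ _ _).hom := by
  rw [rightUnitNat_comp]
  simp

end

end BicategorySquare

/-! ### Comodule laws as equations between pastings -/

namespace MonoidalBicategory

open BicategorySquare

variable {𝓜 : Type u} [Bicategory.{w, v} 𝓜] [MonoidalBicategory 𝓜]

section

variable {M N : 𝓜} {p : ProductUnit M} {q : ProductUnit N} {A B : 𝓜}

/-- The unit corrections `preLeft` and `postLeft` are exactly those hidden in `idArrow h`, so
whiskering by `h` in the second variable is a tensor product of squares. -/
lemma preLeft_comp_postLeft_inv {X Y Z W X' Y' : 𝓜} (f : X ⟶ Y) (g : Y ⟶ W) (f' : X ⟶ Z)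
    (g' : Z ⟶ W) (h : X' ⟶ Y') (y : f ≫ g ⟶ f' ≫ g') :
    (preLeft f g h).hom ≫ (y ⊠₂ 𝟙 h) ≫ (postLeft f' g' h).inv = tsq y (idArrow h) := by
  simp [preLeft, postLeft, tensorIso, tsq, idArrow, ← tensorCell_comp_assoc]

lemma preRight_comp_postRight_inv {X Y X' Y' Z' W' : 𝓜} (h : X ⟶ Y) (f : X' ⟶ Y') (g : Y' ⟶ W')
    (f' : X' ⟶ Z') (g' : Z' ⟶ W') (y : f ≫ g ⟶ f' ≫ g') :
    (preRight h f g).hom ≫ (𝟙 h ⊠₂ y) ≫ (postRight h f' g').inv = tsq (idArrow h) y := by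
  simp [preRight, postRight, tensorIso, tsq, idArrow, ← tensorCell_comp_assoc]

lemma preRight_comp_tensorLR_inv {X Y X' Y' Z' : 𝓜} (h : X ⟶ Y) (f : X' ⟶ Y') (g : Y' ⟶ Z')
    (f' : X' ⟶ Z') (y : f ≫ g ⟶ f') :
    (preRight h f g).hom ≫ (𝟙 h ⊠₂ y) ≫ (tensorLR h f').inv =
      tsq (idArrow h) (y ≫ (λ_ f').inv) := by
  simp [preRight, tensorLR, tensorIso, tsq, idArrow, ← tensorCell_comp_assoc]

lemma coassociative_iff (a : ActionData p A) (b : ActionData q B) (C : OpmonoidalData p q)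
    (Y : A ⟶ B) (y : a.a ≫ Y ⟶ (Y ⊠₁ C.C) ≫ b.a) :
    Coassociative a b C Y y ↔
      a.a2 ▷ Y ≫ vcomp (tsq y (idArrow C.C)) y =
        vcomp (assocNat Y C.C C.C).inv (vcomp (tsq (idArrow Y) C.C2) y) ≫
          ((Y ⊠₁ C.C) ⊠₁ C.C) ◁ b.a2 := by
  unfold Coassociative
  rw [preLeft_comp_postLeft_inv, preRight_comp_postRight_inv]
  apply Eq.congr
  · simp only [vcomp]
    bicategory
  · simp only [vcomp]
    bicategory

/-- Composing `C0` with `(λ_ q.u).inv` gives it a top edge `𝟙 tensorUnit`, so that it becomes a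
square and can be tensored and pasted like `C2`. -/
lemma counital_iff (a : ActionData p A) (b : ActionData q B) (C : OpmonoidalData p q)
    (Y : A ⟶ B) (y : a.a ≫ Y ⟶ (Y ⊠₁ C.C) ≫ b.a) :
    Counital a b C Y y ↔
      a.a0 ▷ Y =
        vcomp (tsq (idArrow Y) (C.C0 ≫ (λ_ q.u).inv)) y ≫ (Y ⊠₁ 𝟙 tensorUnit) ◁ b.a0 ≫
          (rightUnitNat Y).hom := by
  unfold Counital
  rw [preRight_comp_tensorLR_inv, ← cancel_epi (α_ (𝟙 A ⊠₁ p.u) a.a Y).inv]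
  apply Eq.congr
  · bicategory
  · simp only [vcomp]
    bicategory

variable {L : 𝓜} {r : ProductUnit L}

lemma OpmonoidalData.comp_C2 (C : OpmonoidalData p q) (D : OpmonoidalData q r) :
    (C.comp D).C2 = hcomp C.C2 D.C2 ≫ (tensorComp C.C D.C C.C D.C).inv ▷ r.m := by
  simp only [OpmonoidalData.comp, hcomp]
  bicategory

lemma OpmonoidalData.comp_C0 (C : OpmonoidalData p q) (D : OpmonoidalData q r) :
    (C.comp D).C0 ≫ (λ_ r.u).inv =
      hcomp (C.C0 ≫ (λ_ q.u).inv) (D.C0 ≫ (λ_ r.u).inv) ≫ (λ_ (𝟙 tensorUnit)).hom ▷ r.u := by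
  simp only [OpmonoidalData.comp, hcomp]
  bicategory

end

/-! ### Composites of coactions are coactions -/

/-- The composite of two coactions over a multiplication cell `μ`. -/
def coactionComp {A B D M : 𝓜} {C : M ⟶ M} (μ : C ≫ C ⟶ C) {Y : A ⟶ B} {Z : B ⟶ D}
    {a : A ⊠ M ⟶ A} {b : B ⊠ M ⟶ B} {c : D ⊠ M ⟶ D} (y : a ≫ Y ⟶ (Y ⊠₁ C) ≫ b)
    (z : b ≫ Z ⟶ (Z ⊠₁ C) ≫ c) : a ≫ Y ≫ Z ⟶ ((Y ≫ Z) ⊠₁ C) ≫ c :=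
  hcomp y z ≫ ((tensorComp Y Z C C).inv ≫ (𝟙 (Y ≫ Z) ⊠₂ μ)) ▷ c

lemma tensor_y {A M : 𝓜} {p : ProductUnit M} {a : ActionData p A} {C : OpmonoidalData p p}
    (μ : C.C ≫ C.C ⟶ C.C) (Y Z : ComoduleData a a C) :
    (ComoduleData.tensor μ Y Z).y = coactionComp μ Y.y Z.y := by
  simp only [ComoduleData.tensor, coactionComp, hcomp]
  bicategory

section

variable {A B D M : 𝓜} {Y : A ⟶ B} {Z : B ⟶ D}

section

variable {C : M ⟶ M} (μ : C ≫ C ⟶ C) {a : A ⊠ M ⟶ A} {b : B ⊠ M ⟶ B} {c : D ⊠ M ⟶ D}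
  (y : a ≫ Y ⟶ (Y ⊠₁ C) ≫ b) (z : b ≫ Z ⟶ (Z ⊠₁ C) ≫ c)

/-- The `μ` on top of the lower square slides through the identity square on `C` in the upper one.
Both rows are then horizontal pastings, and `hcomp_vcomp` regroups them into columns. -/
lemma vcomp_tsq_coactionComp_left :
    vcomp (tsq (coactionComp μ y z) (idArrow C)) (coactionComp μ y z) =
      hcomp (vcomp (tsq y (idArrow C)) y) (vcomp (tsq z (idArrow C)) z) ≫
        ((tensorComp (Y ⊠₁ C) (Z ⊠₁ C) C C).inv ≫
          (((tensorComp Y Z C C).inv ≫ (𝟙 (Y ≫ Z) ⊠₂ μ)) ⊠₂ μ)) ▷ ((c ⊠₁ 𝟙 M) ≫ c) := by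
  have h : (a ⊠₁ 𝟙 M) ◁ (𝟙 (Y ≫ Z) ⊠₂ μ) ≫ tsq (coactionComp μ y z) (idArrow C) =
      tsq (hcomp y z) (hcomp (idArrow C) (idArrow C)) ≫
        (((tensorComp Y Z C C).inv ≫ (𝟙 (Y ≫ Z) ⊠₂ μ)) ⊠₂ μ) ▷ (c ⊠₁ 𝟙 M) := by
    rw [hcomp_idArrow, ← tsq_comp, ← idArrow_naturality, ← comp_tsq, whiskerLeft_id,
      Category.id_comp, coactionComp]
  rw [hcomp_vcomp, ← vcomp_comp]
  -- Only the lower square is unfolded; the upper one stays folded so that `h` applies.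
  conv_lhs => arg 2; rw [coactionComp]
  rw [vcomp_middle, whiskerLeft_comp, Category.assoc, h, tsq_hcomp]
  simp

/-- Here the sliding `μ` meets `C2`. Multiplicativity of `μ`, in the form `h2`, replaces one `C2` by
two side by side, one per column. -/
lemma vcomp_tsq_coactionComp_right {m : M ⊠ M ⟶ M} (C2 : m ≫ C ⟶ (C ⊠₁ C) ≫ m)
    (h2 : m ◁ μ ≫ C2 = (hcomp C2 C2 ≫ (tensorComp C C C C).inv ▷ m) ≫ (μ ⊠₂ μ) ▷ m) :
    vcomp (tsq (idArrow (Y ≫ Z)) C2) (coactionComp μ y z) =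
      hcomp (vcomp (tsq (idArrow Y) C2) y) (vcomp (tsq (idArrow Z) C2) z) ≫
        ((tensorComp Y Z (C ⊠₁ C) (C ⊠₁ C)).inv ≫
          (𝟙 (Y ≫ Z) ⊠₂ ((tensorComp C C C C).inv ≫ (μ ⊠₂ μ)))) ▷ ((𝟙 D ⊠₁ m) ≫ c) := by
  have h : (𝟙 A ⊠₁ m) ◁ (𝟙 (Y ≫ Z) ⊠₂ μ) ≫ tsq (idArrow (Y ≫ Z)) C2 =
      tsq (hcomp (idArrow Y) (idArrow Z)) (hcomp C2 C2) ≫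
        (𝟙 (Y ≫ Z) ⊠₂ ((tensorComp C C C C).inv ≫ (μ ⊠₂ μ))) ▷ (𝟙 D ⊠₁ m) := by
    rw [hcomp_idArrow, ← comp_tsq, h2, ← tsq_comp]
    simp
  rw [hcomp_vcomp, ← vcomp_comp, coactionComp, vcomp_middle, whiskerLeft_comp, Category.assoc, h,
    tsq_hcomp]
  simp

lemma vcomp_tsq_coactionComp_unit {I : 𝓜} {u : I ⟶ M} (C0 : u ≫ C ⟶ 𝟙 I ≫ u)
    (h0 : u ◁ μ ≫ C0 = hcomp C0 C0 ≫ (λ_ (𝟙 I)).hom ▷ u) :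
    vcomp (tsq (idArrow (Y ≫ Z)) C0) (coactionComp μ y z) =
      hcomp (vcomp (tsq (idArrow Y) C0) y) (vcomp (tsq (idArrow Z) C0) z) ≫
        (preLeft Y Z (𝟙 I)).hom ▷ ((𝟙 D ⊠₁ u) ≫ c) := by
  have h : (𝟙 A ⊠₁ u) ◁ (𝟙 (Y ≫ Z) ⊠₂ μ) ≫ tsq (idArrow (Y ≫ Z)) C0 =
      tsq (hcomp (idArrow Y) (idArrow Z)) (hcomp C0 C0) ≫
        (𝟙 (Y ≫ Z) ⊠₂ (λ_ (𝟙 I)).hom) ▷ (𝟙 D ⊠₁ u) := by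
    rw [hcomp_idArrow, ← comp_tsq, h0, ← tsq_comp]
    simp
  rw [hcomp_vcomp, ← vcomp_comp, coactionComp, vcomp_middle, whiskerLeft_comp, Category.assoc, h,
    tsq_hcomp]
  simp [preLeft, tensorIso]

end

variable {p : ProductUnit M} {a : ActionData p A} {b : ActionData p B} {c : ActionData p D}
  {C : OpmonoidalData p p} {y : a.a ≫ Y ⟶ (Y ⊠₁ C.C) ≫ b.a} {z : b.a ≫ Z ⟶ (Z ⊠₁ C.C) ≫ c.a}
  {μ : C.C ≫ C.C ⟶ C.C}

/-- With both sides in columns, `a.a2` enters at the left edge. The law for `Y` turns it into `b.a2`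
on the shared edge, `hcomp_middle` hands it to the other column, and the law for `Z` turns it into
`c.a2` on the right edge. -/
lemma Coassociative.coactionComp (hμ : OpmonoidalData.IsOpmonoidalCell (C.comp C) C μ)
    (hy : Coassociative a b C Y y) (hz : Coassociative b c C Z z) :
    Coassociative a c C (Y ≫ Z) (coactionComp μ y z) := by
  rw [coassociative_iff] at *
  have h2 := hμ.mul
  rw [OpmonoidalData.comp_C2] at h2
  -- The cells left over on top of the `C2` row must cross the associativity square. `μ` crosses by
  -- naturality, and the square for the composite arrows splits into two; the interchange constraint
  -- this produces cancels the one already there (`e₁`).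
  have hN : as A M M ◁ ((tensorComp Y Z (C.C ⊠₁ C.C) (C.C ⊠₁ C.C)).inv ≫
        (𝟙 (Y ≫ Z) ⊠₂ ((tensorComp C.C C.C C.C C.C).inv ≫ (μ ⊠₂ μ)))) ≫
        (assocNat (Y ≫ Z) C.C C.C).inv =
      hcomp (assocNat Y C.C C.C).inv (assocNat Z C.C C.C).inv ≫
        ((tensorComp (Y ⊠₁ C.C) (Z ⊠₁ C.C) C.C C.C).inv ≫
          (((tensorComp Y Z C.C C.C).inv ≫ (𝟙 (Y ≫ Z) ⊠₂ μ)) ⊠₂ μ)) ▷ as D M M := by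
    have e₁ : as A M M ◁ (𝟙 (Y ≫ Z) ⊠₂ (tensorComp C.C C.C C.C C.C).inv) ≫
        as A M M ◁ (𝟙 (Y ≫ Z) ⊠₂ (tensorComp C.C C.C C.C C.C).hom) = 𝟙 _ := by
      rw [← whiskerLeft_comp, ← tensorCell_comp, Iso.inv_hom_id, Category.comp_id, tensorCell_id,
        whiskerLeft_id]
    have e₂ : ((tensorComp Y Z C.C C.C).inv ⊠₂ 𝟙 (C.C ≫ C.C)) ≫ ((𝟙 (Y ≫ Z) ⊠₂ μ) ⊠₂ μ) =
        ((tensorComp Y Z C.C C.C).inv ≫ (𝟙 (Y ≫ Z) ⊠₂ μ)) ⊠₂ μ := by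
      rw [← tensorCell_comp, Category.id_comp]
    have e₃ : 𝟙 (Y ≫ Z) ⊠₂ ((tensorComp C.C C.C C.C C.C).inv ≫ (μ ⊠₂ μ)) =
        (𝟙 (Y ≫ Z) ⊠₂ (tensorComp C.C C.C C.C C.C).inv) ≫ (𝟙 (Y ≫ Z) ⊠₂ (μ ⊠₂ μ)) := by
      rw [← tensorCell_comp, Category.comp_id]
    rw [← e₂, e₃, whiskerLeft_comp, whiskerLeft_comp, Category.assoc, Category.assoc,
      assocNat_inv_cell, assocNat_inv_comp]
    simp only [Category.assoc, whiskerLeft_comp]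
    rw [reassoc_of% e₁]
    simp
  rw [vcomp_tsq_coactionComp_left, vcomp_tsq_coactionComp_right μ y z C.C2 h2, vcomp_middle, hN,
    vcomp_comp, ← hcomp_vcomp, ← Category.assoc, ← comp_hcomp, hy, hcomp_middle, hz, hcomp_comp,
    Category.assoc, Category.assoc, whisker_exchange]

lemma Counital.coactionComp (hμ : OpmonoidalData.IsOpmonoidalCell (C.comp C) C μ)
    (hy : Counital a b C Y y) (hz : Counital b c C Z z) :
    Counital a c C (Y ≫ Z) (coactionComp μ y z) := by
  rw [counital_iff] at *
  have h0 := hμ.unit =≫ (λ_ p.u).inv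
  rw [OpmonoidalData.comp_C0, Category.assoc] at h0
  rw [vcomp_tsq_coactionComp_unit μ y z _ h0, Category.assoc, ← whisker_exchange_assoc]
  erw [rightUnitNat_comp']
  generalize vcomp (tsq (idArrow Y) (C.C0 ≫ (λ_ p.u).inv)) y = V at *
  -- Only the counit equations satisfied by the two columns matter from here on.
  generalize vcomp (tsq (idArrow Z) (C.C0 ≫ (λ_ p.u).inv)) z = W at *
  -- Bracketed so that `hz` collapses the inner part to `b.a0 ▷ Z`, after which `hy` collapses the
  -- rest to `a.a0 ▷ Y`.
  trans (α_ _ _ _).inv ≫ V ▷ Z ≫ (α_ _ _ _).hom ≫ (Y ⊠₁ 𝟙 tensorUnit) ◁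
    (W ≫ (Z ⊠₁ 𝟙 tensorUnit) ◁ c.a0 ≫ (rightUnitNat Z).hom) ≫ (α_ _ _ _).inv ≫
        (rightUnitNat Y).hom ▷ Z ≫ (α_ _ _ _).hom
  · rw [← hz]
    trans (α_ _ _ _).inv ≫ (V ≫ (Y ⊠₁ 𝟙 tensorUnit) ◁ b.a0 ≫ (rightUnitNat Y).hom) ▷ Z ≫ 
      (α_ _ _ _).hom
    · rw [← hy]
      simp
    · simp
  · simp [hcomp]

end

end MonoidalBicategory

/-! ### The unit comodule -/

namespace MonoidalBicategory

open BicategorySquare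

variable {𝓜 : Type u} [Bicategory.{w, v} 𝓜] [MonoidalBicategory 𝓜]

/-- The coaction on an identity arrow induced by a unit cell `η`. -/
def unitCoaction {A M : 𝓜} {C : M ⟶ M} (η : 𝟙 M ⟶ C) (a : A ⊠ M ⟶ A) :
    a ≫ 𝟙 A ⟶ (𝟙 A ⊠₁ C) ≫ a :=
  arrowId a ≫ ((tensorId A M).inv ≫ (𝟙 (𝟙 A) ⊠₂ η)) ▷ a

section

variable {A M : 𝓜} {C : M ⟶ M} (η : 𝟙 M ⟶ C) (a : A ⊠ M ⟶ A)

/-- The same sliding argument with `η` for `μ` and `arrowId` for horizontal pasting. -/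
lemma vcomp_tsq_unitCoaction_left :
    vcomp (tsq (unitCoaction η a) (idArrow C)) (unitCoaction η a) =
      arrowId ((a ⊠₁ 𝟙 M) ≫ a) ≫ ((tensorId (A ⊠ M) M).inv ≫
        (((tensorId A M).inv ≫ (𝟙 (𝟙 A) ⊠₂ η)) ⊠₂ η)) ▷ ((a ⊠₁ 𝟙 M) ≫ a) := by
  have h : (a ⊠₁ 𝟙 M) ◁ (𝟙 (𝟙 A) ⊠₂ η) ≫ tsq (unitCoaction η a) (idArrow C) =
      tsq (arrowId a) (arrowId (𝟙 M)) ≫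
        (((tensorId A M).inv ≫ (𝟙 (𝟙 A) ⊠₂ η)) ⊠₂ η) ▷ (a ⊠₁ 𝟙 M) := by
    rw [← idArrow_id, ← tsq_comp, ← idArrow_naturality, ← comp_tsq, whiskerLeft_id,
      Category.id_comp, unitCoaction]
  rw [← vcomp_arrowId, ← vcomp_comp]
  conv_lhs => arg 2; rw [unitCoaction]
  rw [vcomp_middle, whiskerLeft_comp, Category.assoc, h, tsq_arrowId]
  simp

lemma vcomp_tsq_unitCoaction_right {m : M ⊠ M ⟶ M} (C2 : m ≫ C ⟶ (C ⊠₁ C) ≫ m)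
    (h2 : m ◁ η ≫ C2 = (arrowId m ≫ (tensorId M M).inv ▷ m) ≫ (η ⊠₂ η) ▷ m) :
    vcomp (tsq (idArrow (𝟙 A)) C2) (unitCoaction η a) =
      arrowId ((𝟙 A ⊠₁ m) ≫ a) ≫ ((tensorId A (M ⊠ M)).inv ≫
          (𝟙 (𝟙 A) ⊠₂ ((tensorId M M).inv ≫ (η ⊠₂ η)))) ▷ ((𝟙 A ⊠₁ m) ≫ a) := by
  have h : (𝟙 A ⊠₁ m) ◁ (𝟙 (𝟙 A) ⊠₂ η) ≫ tsq (idArrow (𝟙 A)) C2 =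
      tsq (arrowId (𝟙 A)) (arrowId m) ≫
        (𝟙 (𝟙 A) ⊠₂ ((tensorId M M).inv ≫ (η ⊠₂ η))) ▷ (𝟙 A ⊠₁ m) := by
    rw [← idArrow_id, ← comp_tsq, h2, ← tsq_comp]
    simp
  rw [← vcomp_arrowId, ← vcomp_comp, unitCoaction, vcomp_middle, whiskerLeft_comp, Category.assoc,
    h, tsq_arrowId]
  simp

lemma vcomp_tsq_unitCoaction_unit {I : 𝓜} {u : I ⟶ M} (C0 : u ≫ C ⟶ 𝟙 I ≫ u)
    (h0 : u ◁ η ≫ C0 = arrowId u) :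
    vcomp (tsq (idArrow (𝟙 A)) C0) (unitCoaction η a) =
      arrowId ((𝟙 A ⊠₁ u) ≫ a) ≫ (tensorId A I).inv ▷ ((𝟙 A ⊠₁ u) ≫ a) := by
  have h : (𝟙 A ⊠₁ u) ◁ (𝟙 (𝟙 A) ⊠₂ η) ≫ tsq (idArrow (𝟙 A)) C0 =
      tsq (arrowId (𝟙 A)) (arrowId u) := by
    rw [← idArrow_id, ← comp_tsq, h0]
    simp
  rw [← vcomp_arrowId, ← vcomp_comp, unitCoaction, vcomp_middle, whiskerLeft_comp, Category.assoc,
    h, tsq_arrowId]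
  simp

end

section

variable {A M : 𝓜} {p : ProductUnit M} {C : OpmonoidalData p p} {η : 𝟙 M ⟶ C.C}
  (a : ActionData p A)

lemma coassociative_unitCoaction
    (hη : OpmonoidalData.IsOpmonoidalCell (OpmonoidalData.id p) C η) :
    Coassociative a a C (𝟙 A) (unitCoaction η a.a) := by
  rw [coassociative_iff]
  have h2 : p.m ◁ η ≫ C.C2 = (arrowId p.m ≫ (tensorId M M).inv ▷ p.m) ≫ (η ⊠₂ η) ▷ p.m := by
    simpa [OpmonoidalData.id, arrowId] using hη.mul
  have hN : as A M M ◁ ((tensorId A (M ⊠ M)).inv ≫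
        (𝟙 (𝟙 A) ⊠₂ ((tensorId M M).inv ≫ (η ⊠₂ η)))) ≫ (assocNat (𝟙 A) C.C C.C).inv =
      arrowId (as A M M) ≫ ((tensorId (A ⊠ M) M).inv ≫
        (((tensorId A M).inv ≫ (𝟙 (𝟙 A) ⊠₂ η)) ⊠₂ η)) ▷ as A M M := by
    have e₁ : as A M M ◁ (𝟙 (𝟙 A) ⊠₂ (tensorId M M).inv) ≫
        as A M M ◁ (𝟙 (𝟙 A) ⊠₂ (tensorId M M).hom) = 𝟙 _ := by
      rw [← whiskerLeft_comp, ← tensorCell_comp, Iso.inv_hom_id, Category.comp_id, tensorCell_id,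
        whiskerLeft_id]
    have e₂ : ((tensorId A M).inv ⊠₂ 𝟙 (𝟙 M)) ≫ ((𝟙 (𝟙 A) ⊠₂ η) ⊠₂ η) =
        ((tensorId A M).inv ≫ (𝟙 (𝟙 A) ⊠₂ η)) ⊠₂ η := by
      rw [← tensorCell_comp, Category.id_comp]
    have e₃ : 𝟙 (𝟙 A) ⊠₂ ((tensorId M M).inv ≫ (η ⊠₂ η)) =
        (𝟙 (𝟙 A) ⊠₂ (tensorId M M).inv) ≫ (𝟙 (𝟙 A) ⊠₂ (η ⊠₂ η)) := by
      rw [← tensorCell_comp, Category.comp_id]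
    rw [← e₂, e₃, whiskerLeft_comp, whiskerLeft_comp, Category.assoc, Category.assoc,
      assocNat_inv_cell, assocNat_inv_id]
    simp only [Category.assoc, whiskerLeft_comp]
    rw [reassoc_of% e₁]
    simp
  rw [vcomp_tsq_unitCoaction_left, vcomp_tsq_unitCoaction_right η a.a C.C2 h2, vcomp_middle, hN,
    vcomp_comp, vcomp_arrowId, reassoc_of% arrowId_naturality a.a2, Category.assoc,
    whisker_exchange]

lemma counital_unitCoaction
    (hη : OpmonoidalData.IsOpmonoidalCell (OpmonoidalData.id p) C η) :
    Counital a a C (𝟙 A) (unitCoaction η a.a) := by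
  rw [counital_iff]
  have h0 : p.u ◁ η ≫ C.C0 ≫ (λ_ p.u).inv = arrowId p.u := by
    rw [← Category.assoc, arrowId]
    -- The counit cell of the identity opmonoidal arrow is `(ρ_ p.u).hom` by definition.
    exact congrArg (· ≫ (λ_ p.u).inv) hη.unit
  rw [vcomp_tsq_unitCoaction_unit η a.a _ h0, Category.assoc, ← whisker_exchange_assoc,
    rightUnitNat_id, ← reassoc_of% arrowId_naturality a.a0]
  simp [arrowId]

end

/-! ### Whiskerings, associators and unitors respect coactions -/

section

variable {A B D E M : 𝓜} {C : M ⟶ M} {μ : C ≫ C ⟶ C} {Y Y' : A ⟶ B} {Z Z' : B ⟶ D} {W : D ⟶ E}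
  {a : A ⊠ M ⟶ A} {b : B ⊠ M ⟶ B} {c : D ⊠ M ⟶ D} {d : E ⊠ M ⟶ E}

lemma coactionComp_whiskerRight {y : a ≫ Y ⟶ (Y ⊠₁ C) ≫ b} {y' : a ≫ Y' ⟶ (Y' ⊠₁ C) ≫ b}
    (z : b ≫ Z ⟶ (Z ⊠₁ C) ≫ c) {γ : Y ⟶ Y'} (h : a ◁ γ ≫ y' = y ≫ (γ ⊠₂ 𝟙 C) ▷ b) :
    a ◁ γ ▷ Z ≫ coactionComp μ y' z = coactionComp μ y z ≫ ((γ ▷ Z) ⊠₂ 𝟙 C) ▷ c := by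
  have e : (γ ⊠₂ 𝟙 C) ▷ (Z ⊠₁ C) ≫ (tensorComp Y' Z C C).inv ≫ (𝟙 (Y' ≫ Z) ⊠₂ μ) =
      ((tensorComp Y Z C C).inv ≫ (𝟙 (Y ≫ Z) ⊠₂ μ)) ≫ ((γ ▷ Z) ⊠₂ 𝟙 C) := by
    -- `γ` and `μ` act in different tensor factors, hence commute. The identity is written `𝟙 C ▷ C`
    -- so that the naturality of interchange applies.
    have : ((γ ▷ Z) ⊠₂ (𝟙 C ▷ C)) ≫ (𝟙 (Y' ≫ Z) ⊠₂ μ) =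
        (𝟙 (Y ≫ Z) ⊠₂ μ) ≫ ((γ ▷ Z) ⊠₂ 𝟙 C) := by
      simp only [← tensorCell_comp, id_whiskerRight, Category.id_comp, Category.comp_id]
    rw [Category.assoc, ← this, tensorComp_whiskerRight']
    simp
  rw [coactionComp, ← Category.assoc, ← comp_hcomp_left, h, hcomp_comp_left, Category.assoc,
    ← comp_whiskerRight, e, coactionComp, comp_whiskerRight, Category.assoc]

lemma coactionComp_whiskerLeft (y : a ≫ Y ⟶ (Y ⊠₁ C) ≫ b) {z : b ≫ Z ⟶ (Z ⊠₁ C) ≫ c}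
    {z' : b ≫ Z' ⟶ (Z' ⊠₁ C) ≫ c} {γ : Z ⟶ Z'} (h : b ◁ γ ≫ z' = z ≫ (γ ⊠₂ 𝟙 C) ▷ c) :
    a ◁ Y ◁ γ ≫ coactionComp μ y z' = coactionComp μ y z ≫ ((Y ◁ γ) ⊠₂ 𝟙 C) ▷ c := by
  have e : (Y ⊠₁ C) ◁ (γ ⊠₂ 𝟙 C) ≫ (tensorComp Y Z' C C).inv ≫ (𝟙 (Y ≫ Z') ⊠₂ μ) =
      ((tensorComp Y Z C C).inv ≫ (𝟙 (Y ≫ Z) ⊠₂ μ)) ≫ ((Y ◁ γ) ⊠₂ 𝟙 C) := by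
    have : ((Y ◁ γ) ⊠₂ (C ◁ 𝟙 C)) ≫ (𝟙 (Y ≫ Z') ⊠₂ μ) =
        (𝟙 (Y ≫ Z) ⊠₂ μ) ≫ ((Y ◁ γ) ⊠₂ 𝟙 C) := by
      simp only [← tensorCell_comp, whiskerLeft_id, Category.id_comp, Category.comp_id]
    rw [Category.assoc, ← this, tensorComp_whiskerLeft']
    simp
  rw [coactionComp, ← Category.assoc, ← comp_hcomp_right, h, hcomp_comp_right, Category.assoc,
    ← comp_whiskerRight, e, coactionComp, comp_whiskerRight, Category.assoc]

/-- Pasting of the squares is associative by `hcomp_assoc`. What remains, `e`, concerns only the top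
edge and combines the associativity axiom for interchange with that of `μ`. -/
lemma coactionComp_assoc (μ_assoc : μ ▷ C ≫ μ = (α_ C C C).hom ≫ C ◁ μ ≫ μ)
    (y : a ≫ Y ⟶ (Y ⊠₁ C) ≫ b) (z : b ≫ Z ⟶ (Z ⊠₁ C) ≫ c) (t : c ≫ W ⟶ (W ⊠₁ C) ≫ d) :
    a ◁ (α_ Y Z W).hom ≫ coactionComp μ y (coactionComp μ z t) =
      coactionComp μ (coactionComp μ y z) t ≫ ((α_ Y Z W).hom ⊠₂ 𝟙 C) ▷ d := by
  have e : ((tensorComp Y Z C C).inv ≫ (𝟙 (Y ≫ Z) ⊠₂ μ)) ▷ (W ⊠₁ C) ≫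
        ((tensorComp (Y ≫ Z) W C C).inv ≫ (𝟙 ((Y ≫ Z) ≫ W) ⊠₂ μ)) ≫ ((α_ Y Z W).hom ⊠₂ 𝟙 C) =
      (α_ _ _ _).hom ≫ (Y ⊠₁ C) ◁ ((tensorComp Z W C C).inv ≫ (𝟙 (Z ≫ W) ⊠₂ μ)) ≫
        (tensorComp Y (Z ≫ W) C C).inv ≫ (𝟙 (Y ≫ Z ≫ W) ⊠₂ μ) := by
    have h : ((𝟙 (Y ≫ Z) ▷ W) ⊠₂ (μ ▷ C)) ≫ (𝟙 ((Y ≫ Z) ≫ W) ⊠₂ μ) ≫ ((α_ Y Z W).hom ⊠₂ 𝟙 C) =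
        ((α_ Y Z W).hom ⊠₂ (α_ C C C).hom) ≫ ((Y ◁ 𝟙 (Z ≫ W)) ⊠₂ (C ◁ μ)) ≫
          (𝟙 (Y ≫ Z ≫ W) ⊠₂ μ) := by
      simp only [← tensorCell_comp, id_whiskerRight, whiskerLeft_id, Category.id_comp,
        Category.comp_id, μ_assoc]
    rw [tensorCell_associator_hom, tensorComp_whiskerLeft', tensorComp_whiskerRight'] at h
    -- Restoring the invertible constraints in front turns the goal into `h`.
    rw [← cancel_epi ((tensorComp Y Z C C).hom ▷ (W ⊠₁ C)),
      ← cancel_epi (tensorComp (Y ≫ Z) W (C ≫ C) C).hom]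
    simpa using h
  rw [coactionComp, coactionComp, hcomp_comp_right, Category.assoc, ← reassoc_of% hcomp_assoc,
    coactionComp, coactionComp, hcomp_comp_left, Category.assoc, Category.assoc,
    ← comp_whiskerRight, ← comp_whiskerRight, ← comp_whiskerRight, ← comp_whiskerRight, e]

lemma unitCoaction_coactionComp {η : 𝟙 M ⟶ C} (η_μ : η ▷ C ≫ μ = (λ_ C).hom)
    (y : a ≫ Y ⟶ (Y ⊠₁ C) ≫ b) :
    a ◁ (λ_ Y).hom ≫ y = coactionComp μ (unitCoaction η a) y ≫ ((λ_ Y).hom ⊠₂ 𝟙 C) ▷ b := by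
  have e : ((tensorId A M).inv ≫ (𝟙 (𝟙 A) ⊠₂ η)) ▷ (Y ⊠₁ C) ≫
      ((tensorComp (𝟙 A) Y C C).inv ≫ (𝟙 (𝟙 A ≫ Y) ⊠₂ μ)) ≫ ((λ_ Y).hom ⊠₂ 𝟙 C) =
      (λ_ (Y ⊠₁ C)).hom := by
    have h : ((𝟙 (𝟙 A) ▷ Y) ⊠₂ (η ▷ C)) ≫ (𝟙 (𝟙 A ≫ Y) ⊠₂ μ) ≫ ((λ_ Y).hom ⊠₂ 𝟙 C) =
        (λ_ Y).hom ⊠₂ (λ_ C).hom := by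
      simp only [← tensorCell_comp, id_whiskerRight, Category.id_comp, Category.comp_id, η_μ]
    rw [tensorComp_whiskerRight', tensorComp_id_left] at h
    rw [← cancel_epi ((tensorId A M).hom ▷ (Y ⊠₁ C)),
      ← cancel_epi (tensorComp (𝟙 A) Y (𝟙 M) C).hom]
    simpa using h
  rw [coactionComp, unitCoaction, hcomp_comp_left, Category.assoc, Category.assoc,
    ← comp_whiskerRight, ← comp_whiskerRight, e, hcomp_arrowId_left]

lemma coactionComp_unitCoaction {η : 𝟙 M ⟶ C} (μ_η : C ◁ η ≫ μ = (ρ_ C).hom)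
    (y : a ≫ Y ⟶ (Y ⊠₁ C) ≫ b) :
    a ◁ (ρ_ Y).hom ≫ y = coactionComp μ y (unitCoaction η b) ≫ ((ρ_ Y).hom ⊠₂ 𝟙 C) ▷ b := by
  have e : (Y ⊠₁ C) ◁ ((tensorId B M).inv ≫ (𝟙 (𝟙 B) ⊠₂ η)) ≫
      ((tensorComp Y (𝟙 B) C C).inv ≫ (𝟙 (Y ≫ 𝟙 B) ⊠₂ μ)) ≫ ((ρ_ Y).hom ⊠₂ 𝟙 C) =
      (ρ_ (Y ⊠₁ C)).hom := by
    have h : ((Y ◁ 𝟙 (𝟙 B)) ⊠₂ (C ◁ η)) ≫ (𝟙 (Y ≫ 𝟙 B) ⊠₂ μ) ≫ ((ρ_ Y).hom ⊠₂ 𝟙 C) =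
        (ρ_ Y).hom ⊠₂ (ρ_ C).hom := by
      simp only [← tensorCell_comp, whiskerLeft_id, Category.id_comp, Category.comp_id, μ_η]
    rw [tensorComp_whiskerLeft', tensorComp_id_right] at h
    rw [← cancel_epi ((Y ⊠₁ C) ◁ (tensorId B M).hom),
      ← cancel_epi (tensorComp Y (𝟙 B) C (𝟙 M)).hom]
    simpa using h
  rw [coactionComp, unitCoaction, hcomp_comp_right, Category.assoc, Category.assoc,
    ← comp_whiskerRight, ← comp_whiskerRight, e, hcomp_arrowId_right]

end

end MonoidalBicategory

/-! ### The monoidal category of comodules -/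

namespace MonoidalBicategory

open BicategorySquare

variable {𝓜 : Type u} [Bicategory.{w, v} 𝓜] [MonoidalBicategory 𝓜]

lemma unit_y {A M : 𝓜} {p : ProductUnit M} (a : ActionData p A) {C : OpmonoidalData p p}
    (η : 𝟙 M ⟶ C.C) : (ComoduleData.unit a η).y = unitCoaction η a.a := by
  simp [ComoduleData.unit, unitCoaction, arrowId]

namespace RightComodule

variable {M : 𝓜} {S : SkewMonoidaleData M} {A : 𝓜} {a : ActionData S.toProductUnit A}
  {B : OpmonoidalMonad S}

/-- The tensor product of right comodules over an opmonoidal monad. -/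
def tensor (Y Z : RightComodule a a B.toOpmonoidalData) :
    RightComodule a a B.toOpmonoidalData where
  toComoduleData := ComoduleData.tensor B.μ Y.toComoduleData Z.toComoduleData
  coassoc := by
    rw [tensor_y]
    exact Y.coassoc.coactionComp B.μ_opmonoidal Z.coassoc
  counit := by
    rw [tensor_y]
    exact Y.counit.coactionComp B.μ_opmonoidal Z.counit

variable (a B) in
/-- The unit right comodule over an opmonoidal monad. -/
def unit : RightComodule a a B.toOpmonoidalData where
  toComoduleData := ComoduleData.unit a B.η
  coassoc := by
    rw [unit_y]
    exact coassociative_unitCoaction a B.η_opmonoidal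
  counit := by
    rw [unit_y]
    exact counital_unitCoaction a B.η_opmonoidal

lemma tensor_y (Y Z : RightComodule a a B.toOpmonoidalData) :
    (tensor Y Z).y = coactionComp B.μ Y.y Z.y :=
  MonoidalBicategory.tensor_y _ _ _

lemma unit_y : (unit a B).y = unitCoaction B.η a.a :=
  MonoidalBicategory.unit_y _ _

/-- An invertible morphism of arrows that is compatible with coactions gives an isomorphism of
comodules. -/
def isoMk {C : OpmonoidalData S.toProductUnit S.toProductUnit} {Y Y' : RightComodule a a C}
    (γ : Y.Y ≅ Y'.Y) (h : a.a ◁ γ.hom ≫ Y'.y = Y.y ≫ (γ.hom ⊠₂ 𝟙 C.C) ▷ a.a) : Y ≅ Y' where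
  hom := ⟨γ.hom, h⟩
  inv :=
    { γ := γ.inv
      comm := by
        have e : (γ.hom ⊠₂ 𝟙 C.C) ≫ (γ.inv ⊠₂ 𝟙 C.C) = 𝟙 _ := by
          rw [← tensorCell_comp, Iso.hom_inv_id, Category.comp_id, tensorCell_id]
        rw [← cancel_epi (a.a ◁ γ.hom), whiskerLeft_hom_inv_assoc, reassoc_of% h,
          ← comp_whiskerRight, e, id_whiskerRight, Category.comp_id] }
  hom_inv_id := Hom.ext γ.hom_inv_id
  inv_hom_id := Hom.ext γ.inv_hom_id

/-- Whiskering of a morphism of comodules by a comodule on the right. -/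
def whiskerRight {Y Y' : RightComodule a a B.toOpmonoidalData} (f : Y ⟶ Y')
    (Z : RightComodule a a B.toOpmonoidalData) : tensor Y Z ⟶ tensor Y' Z where
  γ := Hom.γ f ▷ Z.Y
  comm := by
    rw [tensor_y, tensor_y]
    exact coactionComp_whiskerRight Z.y (Hom.comm f)

/-- Whiskering of a morphism of comodules by a comodule on the left. -/
def whiskerLeft (Y : RightComodule a a B.toOpmonoidalData)
    {Z Z' : RightComodule a a B.toOpmonoidalData} (f : Z ⟶ Z') : tensor Y Z ⟶ tensor Y Z' where
  γ := Y.Y ◁ Hom.γ f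
  comm := by
    rw [tensor_y, tensor_y]
    exact coactionComp_whiskerLeft Y.y (Hom.comm f)

/-- The associator of comodules. -/
def associator (Y Z W : RightComodule a a B.toOpmonoidalData) :
    tensor (tensor Y Z) W ≅ tensor Y (tensor Z W) :=
  isoMk (α_ Y.Y Z.Y W.Y) (by
    rw [tensor_y, tensor_y, tensor_y, tensor_y]
    exact coactionComp_assoc B.μ_assoc Y.y Z.y W.y)

/-- The left unitor of comodules. -/
def leftUnitor (Y : RightComodule a a B.toOpmonoidalData) : tensor (unit a B) Y ≅ Y :=
  isoMk (λ_ Y.Y) (by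
    rw [tensor_y, unit_y]
    exact unitCoaction_coactionComp B.η_μ Y.y)

/-- The right unitor of comodules. -/
def rightUnitor (Y : RightComodule a a B.toOpmonoidalData) : tensor Y (unit a B) ≅ Y :=
  isoMk (ρ_ Y.Y) (by
    rw [tensor_y, unit_y]
    exact coactionComp_unitCoaction B.μ_η Y.y)

variable (a B) in
/-- The tensor product, unit and constraints of the category of right comodules. -/
@[reducible]
def monoidalCategoryStruct : MonoidalCategoryStruct (RightComodule a a B.toOpmonoidalData) where
  tensorObj := tensor
  whiskerLeft Y _ _ f := whiskerLeft Y f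
  whiskerRight f Z := whiskerRight f Z
  tensorUnit := unit a B
  associator := associator
  leftUnitor := leftUnitor
  rightUnitor := rightUnitor

/-- Faithfulness lets the monoidal axioms be checked after forgetting coactions. -/
instance (C : OpmonoidalData S.toProductUnit S.toProductUnit) : (forget a a C).Faithful where
  map_injective h := Hom.ext h

variable (a B) in
/-- The forgetful functor preserves the monoidal data on comodules on the nose. -/
def inducingFunctorData :
    letI := monoidalCategoryStruct a B
    Monoidal.InducingFunctorData (forget a a B.toOpmonoidalData) :=
  letI := monoidalCategoryStruct a B
  { μIso := fun Y Z => Iso.refl (Y.Y ≫ Z.Y)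
    εIso := Iso.refl (𝟙 A)
    whiskerLeft_eq := fun _ _ _ _ => ((Category.id_comp _).trans (Category.comp_id _)).symm
    whiskerRight_eq := fun _ _ => ((Category.id_comp _).trans (Category.comp_id _)).symm
    tensorHom_eq := fun _ _ => ((Category.id_comp _).trans (Category.comp_id _)).symm
    associator_eq := fun Y Z W => by
      change (α_ Y.Y Z.Y W.Y).hom = (𝟙 ((Y.Y ≫ Z.Y) ≫ W.Y) ≫
        MonoidalCategoryStruct.tensorHom (𝟙 (Y.Y ≫ Z.Y)) (𝟙 W.Y)) ≫ (α_ Y.Y Z.Y W.Y).hom ≫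
          MonoidalCategoryStruct.tensorHom (𝟙 Y.Y) (𝟙 (Z.Y ≫ W.Y)) ≫ 𝟙 (Y.Y ≫ Z.Y ≫ W.Y)
      erw [MonoidalCategory.id_tensorHom_id, MonoidalCategory.id_tensorHom_id, Category.id_comp,
        Category.id_comp, Category.comp_id, Category.comp_id]
    leftUnitor_eq := fun Y => by
      change (λ_ Y.Y).hom = (𝟙 (𝟙 A ≫ Y.Y) ≫
        MonoidalCategoryStruct.tensorHom (𝟙 (𝟙 A)) (𝟙 Y.Y)) ≫ (λ_ Y.Y).hom
      erw [MonoidalCategory.id_tensorHom_id, Category.id_comp, Category.id_comp]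
    rightUnitor_eq := fun Y => by
      change (ρ_ Y.Y).hom = (𝟙 (Y.Y ≫ 𝟙 A) ≫
        MonoidalCategoryStruct.tensorHom (𝟙 Y.Y) (𝟙 (𝟙 A))) ≫ (ρ_ Y.Y).hom
      erw [MonoidalCategory.id_tensorHom_id, Category.id_comp, Category.id_comp] }

end RightComodule

theorem hasComodMonoidalStructure {M : 𝓜} {S : SkewMonoidaleData M} {A : 𝓜}
    (a : ActionData S.toProductUnit A) (B : OpmonoidalMonad S) :
    HasComodMonoidalStructure a B :=
  letI := RightComodule.monoidalCategoryStruct a B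
  -- Tensor product and unit have the prescribed data definitionally, so each required `eqToHom` is
  -- an identity, as are the constraints chosen in `inducingFunctorData`.
  ⟨Monoidal.induced _ (RightComodule.inducingFunctorData a B), fun _ _ => rfl, rfl,
    Monoidal.fromInducedMonoidal _ (RightComodule.inducingFunctorData a B), fun _ _ => rfl, rfl⟩

end MonoidalBicategory

theorem mainTheorem10 {𝓜 : Type u} [Bicategory.{w, v} 𝓜] [MonoidalBicategory 𝓜] :
    (∀ (A : 𝓜) (M : RightSkewMonoidale 𝓜) (a : OplaxRightAction M A)
      (B : OpmonoidalMonad M.data), HasComodMonoidalStructure a.data B) ∧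
    (∀ (R P : 𝓜) (D : Biduality R P) (B : OpmonoidalMonad D.enveloping),
      HasComodMonoidalStructure D.evaluation B) :=
  ⟨fun _ _ a B => hasComodMonoidalStructure a.data B,
    fun _ _ D B => hasComodMonoidalStructure D.evaluation B⟩
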